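/- **Definitions.** A crossing-free drawing of a graph in the plane places the vertices at distinct points, and its edges pass through no vertices other than their endpoints and meet each other only in common endpoints; a graph is planar if it has a crossing-free drawing whose edges are simple arcs. A *straight-line embedding* of a graph $G$ is an injective map $\pi:V(G)\to\mathbb{R}^2$ such that drawing every edge $uv$ as the segment between $\pi(u)$ and $\pi(v)$ gives a crossing-free drawing. A set $\mathcal{G}$ of planar graphs, all on $n$ vertices, is a *conflict collection* if there is no set $P\subseteq\mathbb{R}^2$ of $n$ points such that every $G\in\mathcal{G}$ has a straight-line embedding that maps all vertices to points of $P$. Let $H$ be the octahedron graph, with six vertices and eight triangular faces $f_1,\dots,f_8$, and for $n\ge 6$ let $$\mathcal{S}_n=\Bigl\{(n_1,\dots,n_8)\in\mathbb{Z}_{\ge 0}^8 : \sum_{i=1}^8 n_i=n-6\Bigr\}.$$ For $s=(n_1,\dots,n_8)\in\mathcal{S}_n$, a *filling of $H$ by $s$* is a graph obtained from $H$ by placing exactly $n_i$ new vertices into the face $f_i$, for every $i$, and then triangulating each face $f_i$ together with the new vertices placed in it. All fillings are regarded as graphs on the common vertex set $\{0,1,\dots,n-1\}$, in which $0,\dots,5$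 are the vertices of $H$ (labelled in a fixed way). **Theorem 3.** For every $n\ge 7!=5040$ there is an explicit conflict collection consisting of $n^{\underline{6}}+1=n(n-1)\cdots(n-5)+1$ planar graphs on the vertex set $\{0,\dots,n-1\}$, constructed as follows. 1. For every $s\in\mathcal{S}_n$ there is a filling of $H$ by $s$. An explicit one, $T_n(s)$, is this: number the new vertices from $6$ on, face by face; if the face $f_i$ has the corners $x,y,z$ (in a fixed order) and contains the new vertices $p_1,\dots,p_k$, add the edges of the path $x\,p_1p_2\cdots p_k$ and join each of $p_1,\dots,p_k$ to both $y$ and $z$. 2. Let $\mathcal{S}_n'$ consist of the lexicographically first $n^{\underline{6}}+1$ elements of $\mathcal{S}_n$ (which has at least that many). Then $\{T_n(s): s\in\mathcal{S}_n'\}$ is a conflict collection with exactly $n^{\underline{6}}+1$ members. 3. More generally, for every subset $\mathcal{S}'\subseteq\mathcal{S}_n$ with $|\mathcal{S}'|=n^{\underline{6}}+1$ and every choice of a filling $T(s)$ of $H$ by $s$ for each $s\in\mathcal{S}'$, the set $\{T(s): s\in\mathcal{S}'\}$ is a conflict collection with exactly $n^{\underline{6}}+1$ members. -/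

import Mathlib

/-- The Euclidean plane. -/
abbrev Plane : Type := EuclideanSpace ℝ (Fin 2)

/-! ### Drawings of graphs in the plane -/

/-- `A` is a simple arc in the plane with endpoints `p` and `q`. -/
def IsSimpleArc (A : Set Plane) (p q : Plane) : Prop :=
  ∃ γ : Path p q, Function.Injective γ ∧ Set.range γ = A

/-- Vertices of `G` are placed according to `π` and the edge `e` is drawn as the set `curve e`.
The drawing is crossing-free: an edge passes through no vertex except its own endpoints, and two
distinct edges meet at most in (the images of) their common endpoints. -/
structure IsCrossingFree {V : Type*} (G : SimpleGraph V) (π : V → Plane)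
    (curve : Sym2 V → Set Plane) : Prop where
  vertex_edge : ∀ e ∈ G.edgeSet, ∀ w : V, π w ∈ curve e → w ∈ e
  edge_edge : ∀ e ∈ G.edgeSet, ∀ e' ∈ G.edgeSet, e ≠ e' →
    curve e ∩ curve e' ⊆ π '' {v | v ∈ e ∧ v ∈ e'}

/-- A graph is planar if it can be drawn in the plane without crossings, with distinct points as
vertices and simple arcs as edges. -/
def IsPlanar {V : Type*} (G : SimpleGraph V) : Prop :=
  ∃ (π : V → Plane) (curve : Sym2 V → Set Plane),
    Function.Injective π ∧
    (∀ u v, G.Adj u v → IsSimpleArc (curve s(u, v)) (π u) (π v)) ∧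
    IsCrossingFree G π curve

/-- The straight-line segment that represents the (potential) edge `e` when the vertices are placed
according to `π`. -/
def edgeSegment {V : Type*} (π : V → Plane) (e : Sym2 V) : Set Plane :=
  Sym2.lift ⟨fun u v => segment ℝ (π u) (π v), fun u v => segment_symm ℝ (π u) (π v)⟩ e

/-- `π` is a straight-line embedding of `G`: it is injective, and drawing every edge as a
straight-line segment yields a crossing-free drawing. -/
def IsStraightLineEmbedding {V : Type*} (G : SimpleGraph V) (π : V → Plane) : Prop :=
  Function.Injective π ∧ IsCrossingFree G π (edgeSegment π)

/-- `G` has a straight-line embedding on the point set `P`. -/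
def EmbedsStraightLineOn {V : Type*} (G : SimpleGraph V) (P : Finset Plane) : Prop :=
  ∃ π : V → Plane, IsStraightLineEmbedding G π ∧ ∀ v, π v ∈ P

/-- A set of `n`-vertex graphs is simultaneously embeddable (without mapping) if some set of `n`
points in the plane admits a straight-line embedding of each of its members. -/
def IsSimultaneouslyEmbeddable {n : ℕ} (𝒢 : Set (SimpleGraph (Fin n))) : Prop :=
  ∃ P : Finset Plane, P.card = n ∧ ∀ G ∈ 𝒢, EmbedsStraightLineOn G P

/-- A conflict collection: a set of planar graphs of the same order `n` which is not
simultaneously embeddable. -/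
def IsConflictCollection {n : ℕ} (𝒢 : Set (SimpleGraph (Fin n))) : Prop :=
  (∀ G ∈ 𝒢, IsPlanar G) ∧ ¬ IsSimultaneouslyEmbeddable 𝒢

/-! ### The octahedron and its fillings -/

/-- The octahedron graph on `{0, …, 5}`; the pairs of antipodal (non-adjacent) vertices are
`{0, 3}`, `{1, 4}` and `{2, 5}`. -/
def octahedron : SimpleGraph (Fin 6) where
  Adj a b := a.val % 3 ≠ b.val % 3
  symm := ⟨fun _ _ h => h.symm⟩
  loopless := ⟨fun _ h => h rfl⟩

/-- The three corners of each of the eight triangular faces of the octahedron. -/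
def octFace : Fin 8 → Fin 3 → Fin 6 :=
  ![![0, 1, 2], ![0, 1, 5], ![0, 4, 2], ![0, 4, 5],
    ![3, 1, 2], ![3, 1, 5], ![3, 4, 2], ![3, 4, 5]]

/-- `T` restricted to `corner '' Fin 3 ∪ N` is a triangulation of a triangle with the three corners
`corner 0`, `corner 1`, `corner 2` and with the vertices in `N` placed in its interior: there are a
triangle in the plane and a placement `ρ` of the vertices such that the edges of `T` are those of a
(geometric) simplicial complex which covers the triangle and whose vertices are exactly the placed
vertices. -/
def IsTriangulatedFace {V : Type*} (T : SimpleGraph V) (corner : Fin 3 → V) (N : Set V) : Prop :=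
  ∃ (ρ : V → Plane) (K : Geometry.SimplicialComplex ℝ Plane),
    AffineIndependent ℝ (ρ ∘ corner) ∧
    Set.InjOn ρ (Set.range corner ∪ N) ∧
    (∀ v ∈ N, ρ v ∈ interior (convexHull ℝ (Set.range (ρ ∘ corner)))) ∧
    K.space = convexHull ℝ (Set.range (ρ ∘ corner)) ∧
    K.vertices = ρ '' (Set.range corner ∪ N) ∧
    ∀ u ∈ Set.range corner ∪ N, ∀ v ∈ Set.range corner ∪ N, u ≠ v →
      (T.Adj u v ↔ ({ρ u, ρ v} : Finset Plane) ∈ K.faces)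

/-- `T` is obtained from the octahedron, whose vertices are the first six vertices of `T`, by
placing exactly `s i` new vertices into the `i`-th face, for each of the eight faces, and
triangulating each face together with the new vertices placed in it. Here `N i` is the set of new
vertices in the `i`-th face. -/
def IsFilledOctahedron {n : ℕ} (h6 : 6 ≤ n) (s : Fin 8 → ℕ) (T : SimpleGraph (Fin n)) : Prop :=
  ∃ N : Fin 8 → Finset (Fin n),
    (∀ i, (N i).card = s i) ∧
    (∀ v : Fin n, 6 ≤ v.val → ∃! i, v ∈ N i) ∧
    (∀ i, ∀ v ∈ N i, 6 ≤ v.val) ∧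
    T.comap (Fin.castLE h6) = octahedron ∧
    (∀ u v, T.Adj u v → ∃ i,
      u ∈ Set.range (Fin.castLE h6 ∘ octFace i) ∪ (N i : Set (Fin n)) ∧
      v ∈ Set.range (Fin.castLE h6 ∘ octFace i) ∪ (N i : Set (Fin n))) ∧
    ∀ i, IsTriangulatedFace T (Fin.castLE h6 ∘ octFace i) (N i : Set (Fin n))

/-- The vectors `(n₁, …, n₈)` of non-negative integers with sum `n - 6`. -/
def faceCounts (n : ℕ) : Finset (Fin 8 → ℕ) :=
  Finset.piAntidiag Finset.univ (n - 6)

/-! ### An explicit choice -/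

/-- `t` precedes `s` in the lexicographic order. -/
abbrev LexPrecedes (t s : Fin 8 → ℕ) : Prop :=
  ∃ i, (∀ j, j < i → t j = s j) ∧ t i < s i

/-- The first `n (n-1) ⋯ (n-5) + 1` elements of `faceCounts n` in the lexicographic order. -/
def selectedCounts (n : ℕ) : Finset (Fin 8 → ℕ) :=
  (faceCounts n).filter fun s =>
    ((faceCounts n).filter fun t => LexPrecedes t s).card < n.descFactorial 6 + 1

/-- The new vertices are numbered face by face, starting from `6`; this is the number of the first
vertex in the `i`-th face. -/
def blockStart (s : Fin 8 → ℕ) (i : Fin 8) : ℕ :=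
  6 + ∑ j ∈ Finset.univ.filter (fun j => j < i), s j

/-- The number `v` is that of a new vertex in the `i`-th face. -/
def InBlock (s : Fin 8 → ℕ) (i : Fin 8) (v : ℕ) : Prop :=
  blockStart s i ≤ v ∧ v < blockStart s i + s i

/-- The explicit filled octahedron. The edges are those of the octahedron together with the
following ones. If the `i`-th face has the corners `x, y, z` and contains the new vertices
`p₁, …, pₖ` (numbered consecutively), then `x p₁ p₂ … pₖ` is a path and each of `p₁, …, pₖ` is
adjacent to both `y` and `z`. -/
def stackedOctahedron (n : ℕ) (s : Fin 8 → ℕ) : SimpleGraph (Fin n) :=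
  SimpleGraph.fromRel fun u v =>
    (∃ a b : Fin 6, u.val = a.val ∧ v.val = b.val ∧ octahedron.Adj a b) ∨
    ∃ i : Fin 8, InBlock s i u.val ∧
      ((InBlock s i v.val ∧ v.val = u.val + 1) ∨
        v.val = (octFace i 1).val ∨ v.val = (octFace i 2).val ∨
        (v.val = (octFace i 0).val ∧ u.val = blockStart s i))

/-- The explicit collection of `n`-vertex graphs. -/
def explicitCollection (n : ℕ) : Set (SimpleGraph (Fin n)) :=
  stackedOctahedron n '' (selectedCounts n : Set (Fin 8 → ℕ))

/-! ### Counting -/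

/-! A straight-line embedding of a filled octahedron on a set `P` of `n` points uses every point of
`P` and places the six octahedron vertices by an injection into `P`. There are `n.descFactorial 6`
such injections, so among one more filling than that, two agree on the octahedron. The heart of the
proof is `FillingData.counts_eq_of_embedding`: the positions of the six vertices, together with `P`,
determine the number of new vertices in each face. The two fillings would then have equal counts, a
contradiction.

Two facts control the drawings. A new vertex is joined to each corner of its face by a path through
new vertices (`IsTriangulatedFace.reachesVia`), and such a path cannot cross an edge of the
octahedron. Moreover, each octahedron edge lies on exactly two faces, so a point off the drawing
lies in an even number of face triangles (`IsStraightLineEmbedding.sum_interior_faceTriangle`); this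
parity takes the place of the Jordan curve theorem. Exactly one face triangle, the outer one,
contains all six vertices. The new vertices drawn inside any other face triangle are exactly those
of that face, and all remaining ones belong to the outer face.

The same paths show that the abstract graph determines the counts, so different vectors give
different graphs. For planarity, the triangulated faces are drawn on the surface of a regular
octahedron, which is projected stereographically from a point off the drawing. The explicit fillings
come from placing the new vertices of a face on a line through a corner; the triangles form a
complex because they are the lower faces of a convex lifting. There are enough vectors because `(n +
1).choose 7` equals (n+1)/7! times `n.descFactorial 6`. -/

theorem lexPrecedes_trans {a b c : Fin 8 → ℕ} (hab : LexPrecedes a b) (hbc : LexPrecedes b c) :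
    LexPrecedes a c := by
  obtain ⟨i, hi, hi'⟩ := hab
  obtain ⟨j, hj, hj'⟩ := hbc
  rcases lt_trichotomy i j with h | h | h
  · exact ⟨i, fun k hk => (hi k hk).trans (hj k (hk.trans h)), hj i h ▸ hi'⟩
  · subst h
    exact ⟨i, fun k hk => (hi k hk).trans (hj k hk), hi'.trans hj'⟩
  · exact ⟨j, fun k hk => (hi k (hk.trans h)).trans (hj k hk), by rw [hi j h]; exact hj'⟩

theorem lexPrecedes_irrefl (a : Fin 8 → ℕ) : ¬ LexPrecedes a a := by
  rintro ⟨i, -, hi⟩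
  exact lt_irrefl _ hi

theorem lexPrecedes_or_of_ne {a b : Fin 8 → ℕ} (hab : a ≠ b) :
    LexPrecedes a b ∨ LexPrecedes b a := by
  classical
  have hne : (Finset.univ.filter fun i => a i ≠ b i).Nonempty := by
    obtain ⟨i, hi⟩ := Function.ne_iff.1 hab
    exact ⟨i, by simpa using hi⟩
  have hm := Finset.min'_mem _ hne
  set m := Finset.min' _ hne with hmdef
  have hlt : ∀ j, j < m → a j = b j := by
    intro j hj
    by_contra hab'
    exact absurd (Finset.min'_le _ j (by simpa using hab')) (not_le.2 hj)
  rcases lt_or_gt_of_ne (Finset.mem_filter.1 hm).2 with h | h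
  · exact Or.inl ⟨m, hlt, h⟩
  · exact Or.inr ⟨m, fun j hj => (hlt j hj).symm, h⟩

/-- An initial segment, with respect to a strict total order, of a finite set. -/
theorem card_filter_rank_lt {α : Type*} (R : α → α → Prop) [DecidableRel R]
    (htrans : ∀ a b c, R a b → R b c → R a c) (hirr : ∀ a, ¬ R a a)
    (htot : ∀ a b, a ≠ b → R a b ∨ R b a) (A : Finset α) (m : ℕ) (hm : m ≤ A.card) :
    (A.filter fun s => (A.filter fun t => R t s).card < m).card = m := by
  classical
  set r : α → ℕ := fun s => (A.filter fun t => R t s).card with hr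
  have hmono : ∀ a ∈ A, ∀ b, R a b → r a < r b := by
    intro a ha b hab
    refine Finset.card_lt_card ⟨fun t ht => ?_, fun h => ?_⟩
    · simp only [Finset.mem_filter] at ht ⊢
      exact ⟨ht.1, htrans _ _ _ ht.2 hab⟩
    · exact hirr a (Finset.mem_filter.1 (h (Finset.mem_filter.2 ⟨ha, hab⟩))).2
  have hinj : Set.InjOn r A := by
    intro a ha b hb hab
    by_contra hne
    rcases htot a b hne with h | h
    · exact (hmono a ha b h).ne hab
    · exact (hmono b hb a h).ne hab.symm
  -- The ranks are distinct and smaller than `A.card`, so each number below `A.card` is a rank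
  -- exactly once.
  have himg : A.image r = Finset.range A.card := by
    refine Finset.eq_of_subset_of_card_le (fun k hk => ?_) ?_
    · obtain ⟨a, ha, rfl⟩ := Finset.mem_image.1 hk
      refine Finset.mem_range.2 (Finset.card_lt_card ⟨Finset.filter_subset _ _, fun h => ?_⟩)
      exact hirr a (Finset.mem_filter.1 (h ha)).2
    · rw [Finset.card_image_of_injOn hinj, Finset.card_range]
  have h2 : (A.filter fun s => r s < m).image r = Finset.range m := by
    ext k
    simp only [Finset.mem_image, Finset.mem_filter, Finset.mem_range]
    constructor
    · rintro ⟨a, ⟨-, h⟩, rfl⟩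
      exact h
    · intro hk
      have : k ∈ A.image r := by
        rw [himg]; exact Finset.mem_range.2 (hk.trans_le hm)
      obtain ⟨a, ha, rfl⟩ := Finset.mem_image.1 this
      exact ⟨a, ⟨ha, hk⟩, rfl⟩
  rw [← Finset.card_image_of_injOn (hinj.mono (Finset.coe_subset.2 (Finset.filter_subset _ _))), h2,
    Finset.card_range]

/-- Stars and bars: the vectors correspond to multisets of size `n - 6` over eight symbols. -/
theorem card_faceCounts {n : ℕ} (hn : 6 ≤ n) : (faceCounts n).card = (n + 1).choose 7 := by
  have h := Finset.map_sym_eq_piAntidiag (Finset.univ : Finset (Fin 8)) (n - 6)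
  rw [faceCounts, ← h, Finset.card_map, Finset.sym_univ, Finset.card_univ, Sym.card_sym_eq_choose,
    Fintype.card_fin, ← Nat.choose_symm (by omega : n - 6 ≤ 8 + (n - 6) - 1)]
  congr 1 <;> omega

/-- This is where 7! enters. With D the falling factorial, 7! times the number of vectors equals
(n+1)D, which is at least 7!·D + D, and D is positive. -/
theorem descFactorial_add_one_le_card_faceCounts {n : ℕ} (hn : 5040 ≤ n) :
    n.descFactorial 6 + 1 ≤ (faceCounts n).card := by
  rw [card_faceCounts (by omega)]
  have h1 : (n + 1).descFactorial 7 = Nat.factorial 7 * (n + 1).choose 7 :=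
    Nat.descFactorial_eq_factorial_mul_choose _ _
  rw [Nat.succ_descFactorial_succ] at h1
  have h2 : 1 ≤ n.descFactorial 6 := Nat.descFactorial_pos.2 (by omega)
  have h3 : Nat.factorial 7 = 5040 := by decide
  rw [h3] at h1
  have h4 : 5041 * n.descFactorial 6 ≤ (n + 1) * n.descFactorial 6 :=
    Nat.mul_le_mul_right _ (by omega)
  omega

theorem selectedCounts_subset (n : ℕ) : selectedCounts n ⊆ faceCounts n :=
  Finset.filter_subset _ _

theorem card_selectedCounts {n : ℕ} (hn : 5040 ≤ n) :
    (selectedCounts n).card = n.descFactorial 6 + 1 :=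
  card_filter_rank_lt LexPrecedes (fun _ _ _ => lexPrecedes_trans) lexPrecedes_irrefl
    (fun _ _ => lexPrecedes_or_of_ne) _ _ (descFactorial_add_one_le_card_faceCounts hn)

theorem sum_of_mem_faceCounts {n : ℕ} {s : Fin 8 → ℕ} (hs : s ∈ faceCounts n) :
    ∑ i, s i = n - 6 := (Finset.mem_piAntidiag.1 hs).1

/-! ### Paths through the new vertices -/

/-- The affine basis of the plane formed by the corners of a triangle. -/
noncomputable def triangleBasis (p : Fin 3 → Plane) (hp : AffineIndependent ℝ p) :
    AffineBasis (Fin 3) ℝ Plane :=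
  ⟨p, hp, by rw [hp.affineSpan_eq_top_iff_card_eq_finrank_add_one]; simp⟩

@[simp]
theorem coe_triangleBasis (p : Fin 3 → Plane) (hp : AffineIndependent ℝ p) :
    (triangleBasis p hp : Fin 3 → Plane) = p := rfl

theorem mem_convexHull_triangle (p : Fin 3 → Plane) (hp : AffineIndependent ℝ p) (x : Plane) :
    x ∈ convexHull ℝ (Set.range p) ↔ ∀ k, 0 ≤ (triangleBasis p hp).coord k x := by
  have h := (triangleBasis p hp).convexHull_eq_nonneg_coord
  rw [coe_triangleBasis] at h
  rw [h]
  rfl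

theorem mem_interior_triangle (p : Fin 3 → Plane) (hp : AffineIndependent ℝ p) (x : Plane) :
    x ∈ interior (convexHull ℝ (Set.range p)) ↔ ∀ k, 0 < (triangleBasis p hp).coord k x := by
  have h := (triangleBasis p hp).interior_convexHull
  rw [coe_triangleBasis] at h
  rw [h]
  rfl

theorem coord_triangleBasis (p : Fin 3 → Plane) (hp : AffineIndependent ℝ p) (k l : Fin 3) :
    (triangleBasis p hp).coord k (p l) = if k = l then 1 else 0 :=
  (triangleBasis p hp).coord_apply k l

-- The faces that miss `v` are finitely many and closed, so a short step from `v` towards `z` ends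
-- in a face that contains `v`. There `l` exceeds `l v`, hence it does so at some vertex of that
-- face.
open Geometry in
theorem exists_neighbor_lt {E : Type*} [DecidableEq E] [NormedAddCommGroup E] [NormedSpace ℝ E]
    (K : SimplicialComplex ℝ E) (hK : K.vertices.Finite) {v : E} (hv : v ∈ K.vertices)
    (hint : v ∈ interior K.space) (l : E →ᵃ[ℝ] ℝ) {z : E} (hz : l v < l z) :
    ∃ w ∈ K.vertices, w ≠ v ∧ ({v, w} : Finset E) ∈ K.faces ∧ l v < l w := by
  have hfin : K.faces.Finite := by
    refine (hK.toFinset.powerset.finite_toSet).subset fun s hs => ?_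
    simp only [Finset.coe_powerset, Set.mem_preimage, Set.mem_powerset_iff,
      Set.Finite.coe_toFinset]
    exact fun x hx => K.down_closed hs (Finset.singleton_subset_iff.2 hx) (by simp)
  set F : Set E := ⋃ s ∈ {s ∈ K.faces | v ∉ s}, convexHull ℝ (s : Set E) with hF
  have hFc : IsClosed F := by
    refine (hfin.subset (Set.sep_subset _ _)).isClosed_biUnion fun s _ => ?_
    exact s.finite_toSet.isCompact_convexHull ℝ |>.isClosed
  have hvF : v ∉ F := by
    simp only [hF, Set.mem_iUnion, not_exists]
    exact fun s hs hvs => hs.2 ((K.vertex_mem_convexHull_iff hv hs.1).1 hvs)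
  have hnhds : interior K.space ∩ Fᶜ ∈ nhds v :=
    Filter.inter_mem (isOpen_interior.mem_nhds hint) (hFc.isOpen_compl.mem_nhds hvF)
  have hcont : Filter.Tendsto (fun t : ℝ => AffineMap.lineMap v z t) (nhds 0) (nhds v) := by
    have : Continuous fun t : ℝ => (AffineMap.lineMap v z : ℝ →ᵃ[ℝ] E) t :=
      AffineMap.lineMap_continuous
    simpa using this.tendsto 0
  obtain ⟨t, ht, ht0⟩ := ((hcont.eventually hnhds).filter_mono
    (nhdsWithin_le_nhds (s := Set.Ioi 0))).and self_mem_nhdsWithin |>.exists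
  obtain ⟨s, hs, hys⟩ := SimplicialComplex.mem_space_iff.1 (interior_subset ht.1)
  have hvs : v ∈ s := by
    by_contra hvs
    exact ht.2 (Set.mem_biUnion (show s ∈ {s ∈ K.faces | v ∉ s} from ⟨hs, hvs⟩) hys)
  have hly : l v < l (AffineMap.lineMap v z t) := by
    rw [AffineMap.apply_lineMap, AffineMap.lineMap_apply_ring]
    have : 0 < t * (l z - l v) := mul_pos ht0 (sub_pos.2 hz)
    linarith
  obtain ⟨w, hws, hw⟩ : ∃ w ∈ s, l v < l w := by
    by_contra! hcon
    have hsub : convexHull ℝ (s : Set E) ⊆ l ⁻¹' Set.Iic (l v) :=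
      convexHull_min (fun w hw => hcon w hw) ((convex_Iic (l v)).affine_preimage l)
    exact absurd (hsub hys) (not_le.2 hly)
  refine ⟨w, K.down_closed hs (Finset.singleton_subset_iff.2 hws) (by simp), ?_,
    K.down_closed hs ?_ (by simp), hw⟩
  · rintro rfl
    exact lt_irrefl _ hw
  · intro x hx
    rcases Finset.mem_insert.1 hx with rfl | hx
    · exact hvs
    · exact Finset.mem_singleton.1 hx ▸ hws

/-- There is a path in `T` from `v` to `c` whose vertices between `v` and `c` lie in `N`. -/
def ReachesVia {V : Type*} (T : SimpleGraph V) (N : Set V) (v c : V) : Prop :=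
  ∃ w, Relation.ReflTransGen (fun a b => T.Adj a b ∧ b ∈ N) v w ∧ T.Adj w c

theorem ReachesVia.mono {V : Type*} {T : SimpleGraph V} {N N' : Set V} (h : N ⊆ N') {v c : V}
    (hv : ReachesVia T N v c) : ReachesVia T N' v c := by
  obtain ⟨w, hw, hc⟩ := hv
  exact ⟨w, Relation.ReflTransGen.mono (fun a b hab => ⟨hab.1, h hab.2⟩) v w hw, hc⟩

/-- Climb the `k`-th barycentric coordinate. A reachable vertex of `N` where it is maximal has a
neighbour where it is larger. By maximality this neighbour is a corner, and the coordinate vanishes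
at every corner except the `k`-th. -/
theorem IsTriangulatedFace.reachesVia {V : Type*} {T : SimpleGraph V} {corner : Fin 3 → V}
    {N : Set V} (hN : N.Finite) (h : IsTriangulatedFace T corner N) {v : V} (hv : v ∈ N)
    (k : Fin 3) : ReachesVia T N v (corner k) := by
  obtain ⟨ρ, K, hind, hinj, hint, hspace, hvert, hadj⟩ := h
  set l := (triangleBasis _ hind).coord k with hl
  set R : Set V := {w | w ∈ N ∧ Relation.ReflTransGen (fun a b => T.Adj a b ∧ b ∈ N) v w} with hR
  have hRfin : R.Finite := hN.subset fun w hw => hw.1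
  obtain ⟨w, hwR, hmax⟩ := Set.exists_max_image R (fun w => l (ρ w)) hRfin
    ⟨v, hv, Relation.ReflTransGen.refl⟩
  have hwU : w ∈ Set.range corner ∪ N := Or.inr hwR.1
  have hpos := (mem_interior_triangle _ hind _).1 (hint w hwR.1)
  have hlt1 : l (ρ w) < 1 := by
    have hsum := (triangleBasis _ hind).sum_coord_apply_eq_one (ρ w)
    rw [Fin.sum_univ_three] at hsum
    have h0 := hpos 0
    have h1 := hpos 1
    have h2 := hpos 2
    rw [hl]
    fin_cases k <;> simp only [Fin.zero_eta, Fin.mk_one, Fin.reduceFinMk] <;> linarith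
  have hK : K.vertices.Finite := by
    rw [hvert]
    exact ((Set.finite_range _).union hN).image _
  obtain ⟨q, hq, hqw, hface, hlq⟩ := exists_neighbor_lt K hK (v := ρ w)
    (hvert ▸ Set.mem_image_of_mem _ hwU) (hspace ▸ hint w hwR.1) l (z := (ρ ∘ corner) k)
    (by rw [hl, coord_triangleBasis, if_pos rfl]; exact hlt1)
  rw [hvert] at hq
  obtain ⟨u, hu, rfl⟩ := hq
  have hwu : w ≠ u := fun h => hqw (h ▸ rfl)
  have hA : T.Adj w u := (hadj w hwU u hu hwu).2 hface
  rcases hu with ⟨j, rfl⟩ | hu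
  · have hjk : k = j := by
      by_contra hne
      have h0 := coord_triangleBasis _ hind k j
      rw [if_neg hne] at h0
      have := hpos k
      change l (ρ (corner j)) = 0 at h0
      rw [h0] at hlq
      exact absurd this (not_lt.2 hlq.le)
    exact ⟨w, hwR.2, hjk ▸ hA⟩
  · exact absurd (hmax u ⟨hu, hwR.2.tail ⟨hA, hu⟩⟩) (not_le.2 hlq)

/-- The data of a filled octahedron. -/
structure FillingData {n : ℕ} (h6 : 6 ≤ n) (s : Fin 8 → ℕ) (T : SimpleGraph (Fin n))
    (N : Fin 8 → Finset (Fin n)) : Prop where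
  card : ∀ i, (N i).card = s i
  unique : ∀ v : Fin n, 6 ≤ v.val → ∃! i, v ∈ N i
  new : ∀ i, ∀ v ∈ N i, 6 ≤ v.val
  comap : T.comap (Fin.castLE h6) = octahedron
  adj : ∀ u v, T.Adj u v → ∃ i,
      u ∈ Set.range (Fin.castLE h6 ∘ octFace i) ∪ (N i : Set (Fin n)) ∧
      v ∈ Set.range (Fin.castLE h6 ∘ octFace i) ∪ (N i : Set (Fin n))
  face : ∀ i, IsTriangulatedFace T (Fin.castLE h6 ∘ octFace i) (N i : Set (Fin n))

theorem isFilledOctahedron_iff {n : ℕ} (h6 : 6 ≤ n) (s : Fin 8 → ℕ) (T : SimpleGraph (Fin n)) :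
    IsFilledOctahedron h6 s T ↔ ∃ N, FillingData h6 s T N :=
  ⟨fun ⟨N, h1, h2, h3, h4, h5, h6⟩ => ⟨N, h1, h2, h3, h4, h5, h6⟩,
    fun ⟨N, h1, h2, h3, h4, h5, h6⟩ => ⟨N, h1, h2, h3, h4, h5, h6⟩⟩

theorem eq_of_octFace_subset {i j : Fin 8}
    (h : ∀ k, octFace i k ∈ Set.range (octFace j)) : i = j := by
  revert h
  simp only [Set.mem_range]
  revert i j
  decide

/-! ### Reading off the face of a new vertex from the graph. -/

namespace FillingData

variable {n : ℕ} {h6 : 6 ≤ n} {s s' : Fin 8 → ℕ} {T : SimpleGraph (Fin n)}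
  {N N' : Fin 8 → Finset (Fin n)}

theorem eq_of_mem (h : FillingData h6 s T N) {v : Fin n} {i j : Fin 8} (hi : v ∈ N i)
    (hj : v ∈ N j) : i = j :=
  (h.unique v (h.new i v hi)).unique hi hj

theorem eq_of_mem_union (h : FillingData h6 s T N) {v : Fin n} {i j : Fin 8} (hi : v ∈ N i)
    (hj : v ∈ Set.range (Fin.castLE h6 ∘ octFace j) ∪ (N j : Set (Fin n))) : i = j := by
  rcases hj with ⟨k, rfl⟩ | hj
  · have := h.new i _ hi
    simp only [Function.comp_apply, Fin.val_castLE] at this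
    omega
  · exact h.eq_of_mem hi hj

theorem adj_of_mem (h : FillingData h6 s T N) {u v : Fin n} {i : Fin 8} (hu : u ∈ N i)
    (huv : T.Adj u v) : v ∈ Set.range (Fin.castLE h6 ∘ octFace i) ∪ (N i : Set (Fin n)) := by
  obtain ⟨j, hj, hj'⟩ := h.adj u v huv
  rwa [h.eq_of_mem_union hu hj]

theorem reachesVia (h : FillingData h6 s T N) {v : Fin n} {i : Fin 8} (hv : v ∈ N i)
    (k : Fin 3) : ReachesVia T {w | 6 ≤ w.val} v (Fin.castLE h6 (octFace i k)) :=
  ((h.face i).reachesVia (N i).finite_toSet hv k).mono fun w hw => h.new i w hw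

/-- Neighbours of a vertex of `N i` are in `N i` or are corners of the face, and corners are not
new. A path through new vertices therefore stays in `N i` until its last edge. -/
theorem mem_octFace_of_reachesVia (h : FillingData h6 s T N) {v : Fin n} {i : Fin 8}
    (hv : v ∈ N i) {c : Fin 6} (hc : ReachesVia T {w | 6 ≤ w.val} v (Fin.castLE h6 c)) :
    c ∈ Set.range (octFace i) := by
  obtain ⟨w, hw, hwc⟩ := hc
  have hwN : w ∈ N i := by
    clear hwc
    induction hw with
    | refl => exact hv
    | tail _ hab ih =>
      rcases h.adj_of_mem ih hab.1 with ⟨k, rfl⟩ | hb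
      · have := hab.2
        simp only [Function.comp_apply, Set.mem_ofPred_eq, Fin.val_castLE] at this
        omega
      · exact hb
  rcases h.adj_of_mem hwN hwc with ⟨k, hk⟩ | hb
  · exact ⟨k, Fin.castLE_injective h6 hk⟩
  · have := h.new i _ hb
    simp only [Fin.val_castLE] at this
    omega

/-- Reachability through new vertices depends on `T` alone: from `v` all corners of face `i` are
reached, and only corners of face `j` can be. -/
theorem index_eq (h : FillingData h6 s T N) (h' : FillingData h6 s' T N') {v : Fin n}
    {i j : Fin 8} (hi : v ∈ N i) (hj : v ∈ N' j) : i = j :=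
  eq_of_octFace_subset fun k => h'.mem_octFace_of_reachesVia hj (h.reachesVia hi k)

/-- The number of vertices in each face is determined by the graph. -/
theorem counts_eq (h : FillingData h6 s T N) (h' : FillingData h6 s' T N') : s = s' := by
  funext i
  rw [← h.card i, ← h'.card i]
  congr 1
  ext v
  constructor
  · intro hv
    obtain ⟨j, hj, -⟩ := h'.unique v (h.new i v hv)
    rwa [h.index_eq h' hv hj]
  · intro hv
    obtain ⟨j, hj, -⟩ := h.unique v (h'.new i v hv)
    rwa [h'.index_eq h hv hj]

end FillingData

/-! ### Segments and triangles in the plane -/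

/-- Otherwise the disjoint open sets `interior C` and `Cᶜ` would disconnect the segment. Every later
argument that an edge leaving a triangle meets one of its sides starts here. -/
theorem exists_mem_segment_boundary {E : Type*} [NormedAddCommGroup E] [NormedSpace ℝ E]
    {C : Set E} (hC : IsClosed C) {a b : E} (ha : a ∈ interior C) (hb : b ∉ interior C) :
    ∃ z ∈ segment ℝ a b, z ∈ C ∧ z ∉ interior C := by
  by_contra! hcon
  have hpre := (convex_segment (𝕜 := ℝ) a b).isPreconnected
  have hsub : segment ℝ a b ⊆ interior C ∪ Cᶜ := by
    intro z hz
    by_cases h : z ∈ C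
    · exact Or.inl (hcon z hz h)
    · exact Or.inr h
  have hbC : b ∉ C := fun h => hb (hcon b (right_mem_segment ℝ a b) h)
  obtain ⟨z, -, hz1, hz2⟩ := hpre _ _ isOpen_interior hC.isOpen_compl hsub
    ⟨a, left_mem_segment ℝ a b, ha⟩ ⟨b, right_mem_segment ℝ a b, hbC⟩
  exact hz2 (interior_subset hz1)

theorem interior_segment_eq_empty (a b : Plane) : interior (segment ℝ a b) = ∅ := by
  rw [← convexHull_pair, ← Set.not_nonempty_iff_eq_empty,
    interior_convexHull_nonempty_iff_affineSpan_eq_top]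
  intro h
  have h1 := collinear_iff_finrank_le_one.1 (collinear_pair ℝ a b)
  rw [← direction_affineSpan, h, AffineSubspace.direction_top, finrank_top] at h1
  simp at h1

/-- A nonempty open set in the plane is not covered by finitely many segments. -/
theorem exists_mem_forall_notMem_segment {ι : Type*} [Finite ι] (a b : ι → Plane) {U : Set Plane}
    (hU : IsOpen U) (hne : U.Nonempty) : ∃ x ∈ U, ∀ i, x ∉ segment ℝ (a i) (b i) := by
  have hclosed : ∀ i, IsClosed (segment ℝ (a i) (b i)) := fun i => by
    rw [← convexHull_pair]
    exact (Set.toFinite _).isClosed_convexHull ℝ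
  have hd : Dense (⋂ i, (segment ℝ (a i) (b i))ᶜ) :=
    dense_iInter_of_isOpen (fun i => (hclosed i).isOpen_compl)
      fun i => interior_eq_empty_iff_dense_compl.1 (interior_segment_eq_empty _ _)
  obtain ⟨x, hx, hxU⟩ := hd.inter_open_nonempty U hU hne
  exact ⟨x, hx, fun i => Set.mem_iInter.1 hxU i⟩

/-! ### Barycentric coordinates, sides and interior of a triangle. -/

section Triangle

variable {p : Fin 3 → Plane}

theorem isClosed_triangle (p : Fin 3 → Plane) : IsClosed (convexHull ℝ (Set.range p)) :=
  (Set.finite_range p).isClosed_convexHull ℝ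

theorem sum_coord_smul_triangle (hp : AffineIndependent ℝ p) (x : Plane) :
    x = (triangleBasis p hp).coord 0 x • p 0 + (triangleBasis p hp).coord 1 x • p 1 +
      (triangleBasis p hp).coord 2 x • p 2 := by
  have h := (triangleBasis p hp).linear_combination_coord_eq_self x
  rw [Fin.sum_univ_three] at h
  exact h.symm

theorem sum_coord_triangle (hp : AffineIndependent ℝ p) (x : Plane) :
    (triangleBasis p hp).coord 0 x + (triangleBasis p hp).coord 1 x +
      (triangleBasis p hp).coord 2 x = 1 := by
  have h := (triangleBasis p hp).sum_coord_apply_eq_one x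
  rwa [Fin.sum_univ_three] at h

/-- Addition in `Fin 3` is cyclic, so `k + 1` and `k + 2` name the ends of the side opposite to
corner `k`. -/
theorem mem_segment_of_coord_eq_zero (hp : AffineIndependent ℝ p) {x : Plane}
    (hx : ∀ k, 0 ≤ (triangleBasis p hp).coord k x) {k : Fin 3}
    (hk : (triangleBasis p hp).coord k x = 0) :
    x ∈ segment ℝ (p (k + 1)) (p (k + 2)) := by
  have h1 := sum_coord_smul_triangle hp x
  have h2 := sum_coord_triangle hp x
  refine ⟨_, _, hx (k + 1), hx (k + 2), ?_, ?_⟩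
  · fin_cases k <;> simp at hk ⊢ <;> linarith
  · conv_rhs => rw [h1]
    fin_cases k <;> simp at hk ⊢ <;> simp [hk, add_comm]

theorem exists_mem_segment_of_mem_boundary (hp : AffineIndependent ℝ p) {x : Plane}
    (hx : x ∈ convexHull ℝ (Set.range p)) (hx' : x ∉ interior (convexHull ℝ (Set.range p))) :
    ∃ k : Fin 3, x ∈ segment ℝ (p (k + 1)) (p (k + 2)) := by
  rw [mem_convexHull_triangle p hp] at hx
  rw [mem_interior_triangle p hp] at hx'
  push Not at hx'
  obtain ⟨k, hk⟩ := hx'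
  exact ⟨k, mem_segment_of_coord_eq_zero hp hx (le_antisymm hk (hx k))⟩

/-- The coordinate of a corner other than `k` and `l` vanishes on the segment. The case `k = l` is
allowed and handles single corners. -/
theorem notMem_interior_of_mem_segment (hp : AffineIndependent ℝ p) {x : Plane} (k l : Fin 3)
    (hx : x ∈ segment ℝ (p k) (p l)) : x ∉ interior (convexHull ℝ (Set.range p)) := by
  have hm : ∀ k l : Fin 3, ∃ m : Fin 3, m ≠ k ∧ m ≠ l := by decide
  obtain ⟨m, hmk, hml⟩ := hm k l
  intro hint
  have hpos := (mem_interior_triangle p hp x).1 hint m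
  rw [segment_eq_image_lineMap] at hx
  obtain ⟨t, -, rfl⟩ := hx
  rw [AffineMap.apply_lineMap, coord_triangleBasis, coord_triangleBasis, if_neg hmk, if_neg hml,
    AffineMap.lineMap_same] at hpos
  simp at hpos

theorem corner_notMem_interior (hp : AffineIndependent ℝ p) (k : Fin 3) :
    p k ∉ interior (convexHull ℝ (Set.range p)) :=
  notMem_interior_of_mem_segment hp k k (left_mem_segment ℝ _ _)

theorem corner_mem_triangle (p : Fin 3 → Plane) (k : Fin 3) : p k ∈ convexHull ℝ (Set.range p) :=
  subset_convexHull ℝ _ ⟨k, rfl⟩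

theorem interior_triangle_nonempty (hp : AffineIndependent ℝ p) :
    (interior (convexHull ℝ (Set.range p))).Nonempty :=
  ⟨_, (triangleBasis p hp).centroid_mem_interior_convexHull⟩

end Triangle

/-! ### Counting crossings with a ray -/

/-- The orientation of the triangle `a b x`. -/
def orient (a b x : Plane) : ℝ := (a 0 - x 0) * (b 1 - x 1) - (a 1 - x 1) * (b 0 - x 0)

open Classical in
/-- The number modulo 2 of crossings of the segment from `a` to `b` with the horizontal ray that
starts at `x`. -/
noncomputable def rayCrossing (x a b : Plane) : ZMod 2 :=
  -- The ray points to the right. An endpoint at the height of `x` counts as lying below, so a ray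
  -- through a corner is treated consistently by both sides that meet there.
  if (a 1 ≤ x 1 ∧ x 1 < b 1 ∧ 0 < orient a b x) ∨ (b 1 ≤ x 1 ∧ x 1 < a 1 ∧ orient a b x < 0)
  then 1 else 0

theorem orient_swap (a b x : Plane) : orient b a x = -orient a b x := by
  unfold orient; ring

theorem rayCrossing_comm (x a b : Plane) : rayCrossing x a b = rayCrossing x b a := by
  unfold rayCrossing
  simp only [orient_swap a b x, Left.neg_pos_iff, Left.neg_neg_iff]
  congr 1
  exact propext Or.comm

/-- A barycentric coordinate is a quotient of signed areas. This turns the side test of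
`rayCrossing` into the sign of a coordinate. -/
theorem orient_eq_coord_mul {p : Fin 3 → Plane} (hp : AffineIndependent ℝ p) (x : Plane)
    (k : Fin 3) : orient (p (k + 1)) (p (k + 2)) x =
      (triangleBasis p hp).coord k x * orient (p 0) (p 1) (p 2) := by
  have h1 := sum_coord_smul_triangle hp x
  have h2 := sum_coord_triangle hp x
  have e0 := congrArg (fun y : Plane => y 0) h1
  have e1 := congrArg (fun y : Plane => y 1) h1
  simp only [PiLp.add_apply, PiLp.smul_apply, smul_eq_mul] at e0 e1
  set u := (triangleBasis p hp).coord 0 x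
  set v := (triangleBasis p hp).coord 1 x
  set w := (triangleBasis p hp).coord 2 x
  have hu : u = 1 - v - w := by linarith
  unfold orient
  fin_cases k <;> simp only [Fin.zero_eta, Fin.mk_one, Fin.reduceFinMk, Fin.reduceAdd, zero_add] <;>
    rw [e0, e1] <;> simp only [← show u = (triangleBasis p hp).coord 0 x from rfl,
      ← show v = (triangleBasis p hp).coord 1 x from rfl,
      ← show w = (triangleBasis p hp).coord 2 x from rfl] <;> rw [hu] <;> ring

theorem orient_ne_zero {p : Fin 3 → Plane} (hp : AffineIndependent ℝ p) :
    orient (p 0) (p 1) (p 2) ≠ 0 := by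
  intro h
  have h0 := fun x => orient_eq_coord_mul hp x 0
  simp only [h, mul_zero, zero_add] at h0
  -- With zero area, `orient (p 1) (p 2)` would vanish identically. Testing it one unit above and
  -- one unit to the right of `p 1` yields `p 1 = p 2`.
  have h1 := h0 !₂[p 1 0, p 1 1 + 1]
  have h2 := h0 !₂[p 1 0 + 1, p 1 1]
  simp [orient] at h1 h2
  refine absurd (hp.injective (a₁ := 1) (a₂ := 2) ?_) (by decide)
  ext i
  fin_cases i <;> simp <;> linarith

/-- Here `A`, `B`, `C` are the heights of the corners relative to a point with barycentric
coordinates `u`, `v`, `w`, and the horizontal line through the point separates the first corner from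
the others. The relation `u * A + v * B + w * C = 0` excludes `u < 0` when `0 < v` and `0 ≤ w`, and
it excludes `w < 0` together with `v ≤ 0`. The hypotheses `hu` and `hw` keep the point off two of
the sides. -/
theorem forall_pos_iff_xor {A B C u v w : ℝ} (h : u * A + v * B + w * C = 0)
    (hs : u + v + w = 1)
    (hABC : (0 < A ∧ B ≤ 0 ∧ C ≤ 0) ∨ (A ≤ 0 ∧ 0 < B ∧ 0 < C))
    (hu : u = 0 → ¬ (0 ≤ v ∧ 0 ≤ w)) (hw : w = 0 → ¬ (0 ≤ u ∧ 0 ≤ v)) :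
    (0 < u ∧ 0 < v ∧ 0 < w) ↔ Xor (0 < v) (w < 0) := by
  constructor
  · rintro ⟨-, h2, h3⟩
    exact Or.inl ⟨h2, h3.le.not_gt⟩
  · rintro (⟨hv0, hw0⟩ | ⟨hw0, hv0⟩)
    · rw [not_lt] at hw0
      have hu0 : 0 ≤ u := by
        by_contra! hneg
        rcases hABC with ⟨hA, hB, hC⟩ | ⟨hA, hB, hC⟩
        · nlinarith [mul_nonneg hv0.le (neg_nonneg.2 hB), mul_nonneg hw0 (neg_nonneg.2 hC),
            mul_pos (neg_pos.2 hneg) hA]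
        · nlinarith [mul_pos hv0 hB, mul_nonneg hw0 hC.le,
            mul_nonneg (neg_pos.2 hneg).le (neg_nonneg.2 hA)]
      refine ⟨lt_of_le_of_ne hu0 fun h0 => hu h0.symm ⟨hv0.le, hw0⟩, hv0,
        lt_of_le_of_ne hw0 fun h0 => hw h0.symm ⟨hu0, hv0.le⟩⟩
    · rw [not_lt] at hv0
      exfalso
      have hu1 : 1 < u := by linarith
      rcases hABC with ⟨hA, hB, hC⟩ | ⟨hA, hB, hC⟩
      · nlinarith [mul_nonneg (neg_nonneg.2 hv0) (neg_nonneg.2 hB),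
          mul_nonneg (neg_pos.2 hw0).le (neg_nonneg.2 hC), mul_pos (one_pos.trans hu1) hA]
      · nlinarith [mul_nonneg (neg_nonneg.2 hv0) hB.le, mul_pos (neg_pos.2 hw0) hC,
          mul_nonneg (one_pos.trans hu1).le (neg_nonneg.2 hA)]

theorem ite_eq_add_ite_iff (P Q R : Prop) [Decidable P] [Decidable Q] [Decidable R] :
    ((if P then 1 else 0 : ZMod 2) = (if Q then 1 else 0) + (if R then 1 else 0)) ↔
      (P ↔ Xor Q R) := by
  by_cases hP : P <;> by_cases hQ : Q <;> by_cases hR : R <;> simp [hP, hQ, hR, Xor]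
  decide

open Classical in
/-- `rayCrossing` in terms of the heights of the endpoints and the orientation. -/
noncomputable def signCrossing (A B d : ℝ) : ZMod 2 :=
  if (A ≤ 0 ∧ 0 < B ∧ 0 < d) ∨ (B ≤ 0 ∧ 0 < A ∧ d < 0) then 1 else 0

-- The side between the two corners that are not separated is never crossed. Which of the other two
-- sides passes which sign test depends on the sign of `Δ` and on which corners are the upper ones,
-- so `forall_pos_iff_xor` is needed with `B`, `C` in both orders.
open Classical in
theorem signCrossing_add_of_separated {A B C u v w Δ : ℝ} (hΔ : Δ ≠ 0)
    (h : u * A + v * B + w * C = 0) (hs : u + v + w = 1)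
    (hABC : (0 < A ∧ B ≤ 0 ∧ C ≤ 0) ∨ (A ≤ 0 ∧ 0 < B ∧ 0 < C))
    (hu : u = 0 → ¬ (0 ≤ v ∧ 0 ≤ w)) (hv : v = 0 → ¬ (0 ≤ u ∧ 0 ≤ w))
    (hw : w = 0 → ¬ (0 ≤ u ∧ 0 ≤ v)) :
    (if 0 < u ∧ 0 < v ∧ 0 < w then 1 else 0 : ZMod 2) =
      signCrossing A B (w * Δ) + signCrossing B C (u * Δ) + signCrossing C A (v * Δ) := by
  have k1 := forall_pos_iff_xor h hs hABC hu hw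
  have k2 := forall_pos_iff_xor (A := A) (B := C) (C := B) (u := u) (v := w) (w := v)
    (by linarith) (by linarith) (hABC.imp (And.imp_right And.symm) (And.imp_right And.symm))
    (fun h h' => hu h h'.symm) hv
  have hmid : signCrossing B C (u * Δ) = 0 := by
    unfold signCrossing
    refine if_neg ?_
    rcases hABC with ⟨hA, hB, hC⟩ | ⟨hA, hB, hC⟩
    · simp [hB.not_gt, hC.not_gt]
    · simp [hB.not_ge, hC.not_ge]
  rw [hmid, add_zero]
  unfold signCrossing
  rw [ite_eq_add_ite_iff]
  rcases lt_or_gt_of_ne hΔ with hd | hd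
  · have e1 : ∀ t : ℝ, 0 < t * Δ ↔ t < 0 := fun t => by
      constructor
      · intro h; by_contra! h'; nlinarith
      · intro h; nlinarith
    have e2 : ∀ t : ℝ, t * Δ < 0 ↔ 0 < t := fun t => by
      constructor
      · intro h; by_contra! h'; nlinarith
      · intro h; nlinarith
    simp only [e1, e2]
    rcases hABC with ⟨hA, hB, hC⟩ | ⟨hA, hB, hC⟩
    · simp only [hA, hB, hC, hA.not_ge, hB.not_gt, hC.not_gt, false_and, true_and, false_or, and_false,
        or_false]
      exact (and_congr_right fun _ => and_comm).trans k2
    · simp only [hA, hB, hC, hA.not_gt, hB.not_ge, hC.not_ge, false_and, true_and, false_or, and_false,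
        or_false]
      exact k1.trans (iff_of_eq (xor_comm _ _))
  · have e1 : ∀ t : ℝ, 0 < t * Δ ↔ 0 < t := fun t => mul_pos_iff_of_pos_right hd
    have e2 : ∀ t : ℝ, t * Δ < 0 ↔ t < 0 := fun t => by
      constructor
      · intro h; by_contra! h'; nlinarith
      · intro h; nlinarith
    simp only [e1, e2]
    rcases hABC with ⟨hA, hB, hC⟩ | ⟨hA, hB, hC⟩
    · simp only [hA, hB, hC, hA.not_ge, hB.not_gt, hC.not_gt, false_and, true_and, false_or, and_false,
        or_false]
      exact k1.trans (iff_of_eq (xor_comm _ _))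
    · simp only [hA, hB, hC, hA.not_gt, hB.not_ge, hC.not_ge, false_and, true_and, false_or, and_false,
        or_false]
      exact (and_congr_right fun _ => and_comm).trans k2

-- Of the eight sign patterns of the heights, six separate one corner from the others and reduce to
-- the previous lemma by rotation. In the other two no side is crossed, and the point is not
-- interior, since the weighted heights sum to zero; `hz` settles the case of vanishing heights.
open Classical in
theorem signCrossing_add {A B C u v w Δ : ℝ} (hΔ : Δ ≠ 0)
    (h : u * A + v * B + w * C = 0) (hs : u + v + w = 1) (hz : ¬ (A = 0 ∧ B = 0 ∧ C = 0))
    (hu : u = 0 → ¬ (0 ≤ v ∧ 0 ≤ w)) (hv : v = 0 → ¬ (0 ≤ u ∧ 0 ≤ w))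
    (hw : w = 0 → ¬ (0 ≤ u ∧ 0 ≤ v)) :
    (if 0 < u ∧ 0 < v ∧ 0 < w then 1 else 0 : ZMod 2) =
      signCrossing A B (w * Δ) + signCrossing B C (u * Δ) + signCrossing C A (v * Δ) := by
  have a1 := fun H : (0 < A ∧ B ≤ 0 ∧ C ≤ 0) ∨ (A ≤ 0 ∧ 0 < B ∧ 0 < C) =>
     signCrossing_add_of_separated (A := A) (B := B) (C := C) hΔ h hs H hu hv hw
  have a2 := fun H : (0 < B ∧ C ≤ 0 ∧ A ≤ 0) ∨ (B ≤ 0 ∧ 0 < C ∧ 0 < A) =>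
     signCrossing_add_of_separated (A := B) (B := C) (C := A) (u := v) (v := w)
    (w := u) hΔ (by linarith) (by linarith) H (fun h h' => hv h h'.symm)
    (fun h h' => hw h h'.symm) hu
  have a3 := fun H : (0 < C ∧ A ≤ 0 ∧ B ≤ 0) ∨ (C ≤ 0 ∧ 0 < A ∧ 0 < B) =>
     signCrossing_add_of_separated (A := C) (B := A) (C := B) (u := w) (v := u)
    (w := v) hΔ (by linarith) (by linarith) H hw (fun h h' => hu h h'.symm)
    (fun h h' => hv h h'.symm)
  have p2 : (0 < v ∧ 0 < w ∧ 0 < u) ↔ (0 < u ∧ 0 < v ∧ 0 < w) :=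
    ⟨fun ⟨a, b, c⟩ => ⟨c, a, b⟩, fun ⟨a, b, c⟩ => ⟨b, c, a⟩⟩
  have p3 : (0 < w ∧ 0 < u ∧ 0 < v) ↔ (0 < u ∧ 0 < v ∧ 0 < w) :=
    ⟨fun ⟨a, b, c⟩ => ⟨b, c, a⟩, fun ⟨a, b, c⟩ => ⟨c, a, b⟩⟩
  simp only [p2] at a2
  simp only [p3] at a3
  rcases le_or_gt A 0 with hA | hA <;> rcases le_or_gt B 0 with hB | hB <;>
    rcases le_or_gt C 0 with hC | hC
  · have hn : ¬ (0 < u ∧ 0 < v ∧ 0 < w) := by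
      rintro ⟨h1, h2, h3⟩
      have q1 := mul_nonneg h1.le (neg_nonneg.2 hA)
      have q2 := mul_nonneg h2.le (neg_nonneg.2 hB)
      have q3 := mul_nonneg h3.le (neg_nonneg.2 hC)
      refine hz ⟨?_, ?_, ?_⟩
      · exact (mul_eq_zero.1 (show u * A = 0 by linarith)).resolve_left h1.ne'
      · exact (mul_eq_zero.1 (show v * B = 0 by linarith)).resolve_left h2.ne'
      · exact (mul_eq_zero.1 (show w * C = 0 by linarith)).resolve_left h3.ne'
    simp [signCrossing, hn, hA.not_gt, hB.not_gt, hC.not_gt]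
  · rw [a3 (Or.inl ⟨hC, hA, hB⟩)]; ring
  · rw [a2 (Or.inl ⟨hB, hC, hA⟩)]; ring
  · exact a1 (Or.inr ⟨hA, hB, hC⟩)
  · exact a1 (Or.inl ⟨hA, hB, hC⟩)
  · rw [a2 (Or.inr ⟨hB, hC, hA⟩)]; ring
  · rw [a3 (Or.inr ⟨hC, hA, hB⟩)]; ring
  · have hn : ¬ (0 < u ∧ 0 < v ∧ 0 < w) := by
      rintro ⟨h1, h2, h3⟩
      have q1 := mul_pos h1 hA
      have q2 := mul_pos h2 hB
      have q3 := mul_pos h3 hC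
      linarith
    simp [signCrossing, hn, hA.not_ge, hB.not_ge, hC.not_ge]

theorem rayCrossing_eq (x a b : Plane) :
    rayCrossing x a b = signCrossing (a 1 - x 1) (b 1 - x 1) (orient a b x) := by
  simp only [rayCrossing, signCrossing, sub_nonpos, sub_pos]

open Classical in
/-- A point off the boundary lies in a triangle iff a ray crosses the boundary an odd number of
times. -/
theorem interior_triangle_eq_rayCrossing {p : Fin 3 → Plane} (hp : AffineIndependent ℝ p)
    {x : Plane} (hx : ∀ k : Fin 3, x ∉ segment ℝ (p (k + 1)) (p (k + 2))) :
    (if x ∈ interior (convexHull ℝ (Set.range p)) then 1 else 0 : ZMod 2) =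
      rayCrossing x (p 0) (p 1) + rayCrossing x (p 1) (p 2) + rayCrossing x (p 2) (p 0) := by
  have o0 := orient_eq_coord_mul hp x 0
  have o1 := orient_eq_coord_mul hp x 1
  have o2 := orient_eq_coord_mul hp x 2
  simp only [zero_add, Fin.reduceAdd] at o0 o1 o2
  have h1 := sum_coord_smul_triangle hp x
  have hsum := sum_coord_triangle hp x
  have hΔ := orient_ne_zero hp
  have hseg : ∀ k : Fin 3, (triangleBasis p hp).coord k x = 0 →
      ¬ ∀ l, 0 ≤ (triangleBasis p hp).coord l x :=
    fun k hk hl => hx k (mem_segment_of_coord_eq_zero hp hl hk)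
  simp only [Fin.forall_fin_succ,  Fin.succ_zero_eq_one,
    Fin.succ_one_eq_two, IsEmpty.forall_iff, and_true] at hseg
  have e1 := congrArg (fun y : Plane => y 1) h1
  simp only [PiLp.add_apply, PiLp.smul_apply, smul_eq_mul] at e1
  simp only [mem_interior_triangle p hp, Fin.forall_fin_succ, Fin.succ_zero_eq_one,
    Fin.succ_one_eq_two, IsEmpty.forall_iff, and_true]
  rw [rayCrossing_eq, rayCrossing_eq, rayCrossing_eq, o0, o1, o2]
  set u := (triangleBasis p hp).coord 0 x
  set v := (triangleBasis p hp).coord 1 x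
  set w := (triangleBasis p hp).coord 2 x
  obtain ⟨g0, g1, g2⟩ := hseg
  refine signCrossing_add hΔ ?_ hsum ?_ ?_ ?_ ?_
  · have : u * x 1 + v * x 1 + w * x 1 = x 1 := by rw [← add_mul, ← add_mul, hsum, one_mul]
    linarith
  · rintro ⟨z0, z1, z2⟩
    apply hΔ
    unfold orient
    rw [show p 0 1 = p 2 1 by linarith, show p 1 1 = p 2 1 by linarith]
    ring
  · exact fun h h' => g0 h ⟨h.ge, h'.1, h'.2⟩
  · exact fun h h' => g1 h ⟨h'.1, h.ge, h'.2⟩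
  · exact fun h h' => g2 h ⟨h'.1, h'.2, h.ge⟩

/-! ### Straight-line drawings of the octahedron -/

theorem octahedron_adj_octFace (i : Fin 8) {k l : Fin 3} (hkl : k ≠ l) :
    octahedron.Adj (octFace i k) (octFace i l) := by
  have h : ∀ (i : Fin 8) (k l : Fin 3), k ≠ l →
    (octFace i k).val % 3 ≠ (octFace i l).val % 3 := by decide
  exact h i k l hkl

theorem octahedron_adj_octFace_add (i : Fin 8) (k : Fin 3) :
    octahedron.Adj (octFace i (k + 1)) (octFace i (k + 2)) :=
  octahedron_adj_octFace i (by revert k; decide)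

/-- The three vertices off a face form the opposite face. -/
theorem octahedron_adj_of_notMem (i : Fin 8) {a b : Fin 6} (ha : ∀ k, octFace i k ≠ a)
    (hb : ∀ k, octFace i k ≠ b) (hab : a ≠ b) : octahedron.Adj a b := by
  have h : ∀ (i : Fin 8) (a b : Fin 6), (∀ k, octFace i k ≠ a) → (∀ k, octFace i k ≠ b) →
    a ≠ b → a.val % 3 ≠ b.val % 3 := by decide
  exact h i a b ha hb hab

theorem octFace_injective (i : Fin 8) : Function.Injective (octFace i) := by
  have h : ∀ (i : Fin 8) (k l : Fin 3), octFace i k = octFace i l → k = l := by decide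
  exact fun k l => h i k l

theorem exists_notMem_octFace {i j : Fin 8} (hij : i ≠ j) : ∃ k, ∀ l, octFace j l ≠ octFace i k := by
  by_contra! h
  exact hij (eq_of_octFace_subset h)

namespace IsStraightLineEmbedding

variable {V : Type*} {G : SimpleGraph V} {π : V → Plane}

theorem eq_of_mem_segment (h : IsStraightLineEmbedding G π) {u v w : V} (huv : G.Adj u v)
    (hw : π w ∈ segment ℝ (π u) (π v)) : w = u ∨ w = v :=
  Sym2.mem_iff.1 (h.2.vertex_edge s(u, v) huv w hw)

theorem exists_common_of_mem (h : IsStraightLineEmbedding G π) {u v a b : V} (huv : G.Adj u v)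
    (hab : G.Adj a b) (hne : s(u, v) ≠ s(a, b)) {x : Plane} (hx : x ∈ segment ℝ (π u) (π v))
    (hx' : x ∈ segment ℝ (π a) (π b)) : ∃ w, π w = x ∧ (w = u ∨ w = v) ∧ (w = a ∨ w = b) := by
  obtain ⟨w, ⟨hw, hw'⟩, rfl⟩ := h.2.edge_edge _ huv _ hab hne ⟨hx, hx'⟩
  exact ⟨w, rfl, Sym2.mem_iff.1 hw, Sym2.mem_iff.1 hw'⟩

theorem comap (h : IsStraightLineEmbedding G π) {W : Type*} (f : W ↪ V) :
    IsStraightLineEmbedding (G.comap f) (π ∘ f) := by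
  refine ⟨h.1.comp f.injective, ⟨?_, ?_⟩⟩
  · rintro ⟨u, v⟩ huv w hw
    exact Sym2.mem_iff.2 ((h.eq_of_mem_segment (w := f w) huv hw).imp (fun e => f.injective e)
      fun e => f.injective e)
  · rintro ⟨u, v⟩ huv ⟨a, b⟩ hab hne x ⟨hx, hx'⟩
    have hne' : s(f u, f v) ≠ s(f a, f b) := fun e =>
      hne (Sym2.map.injective f.injective (by simpa using e))
    obtain ⟨w, rfl, hw, hw'⟩ := h.exists_common_of_mem huv hab hne' hx hx'
    rcases hw with rfl | rfl
    · exact ⟨u, ⟨Sym2.mem_mk_left _ _, Sym2.mem_iff.2 (hw'.imp (fun e => f.injective e)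
        fun e => f.injective e)⟩, rfl⟩
    · exact ⟨v, ⟨Sym2.mem_mk_right _ _, Sym2.mem_iff.2 (hw'.imp (fun e => f.injective e)
        fun e => f.injective e)⟩, rfl⟩

end IsStraightLineEmbedding

/-- The triangle that is spanned by the corners of the `i`-th face. -/
def faceTriangle (q : Fin 6 → Plane) (i : Fin 8) : Set Plane :=
  convexHull ℝ (Set.range (q ∘ octFace i))

/-! ### Face triangles, their parity and the outer face. -/

namespace IsStraightLineEmbedding

variable {q : Fin 6 → Plane} (hq : IsStraightLineEmbedding octahedron q)
include hq

/-- If the corners were collinear, one of them would lie on the edge between the other two. -/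
theorem affineIndependent_face (i : Fin 8) : AffineIndependent ℝ (q ∘ octFace i) := by
  rw [affineIndependent_iff_not_collinear]
  intro hcol
  have hcol' : Collinear ℝ {q (octFace i 0), q (octFace i 1), q (octFace i 2)} := by
    convert hcol using 1
    ext x
    simp only [Set.mem_insert_iff, Set.mem_singleton_iff, Set.mem_range, Function.comp_apply,
      Fin.exists_fin_succ, Fin.succ_zero_eq_one, Fin.succ_one_eq_two, IsEmpty.exists_iff, or_false]
    tauto
  have hfalse : ∀ a b c : Fin 3, b ≠ a → b ≠ c → a ≠ c →
      ¬ Wbtw ℝ (q (octFace i a)) (q (octFace i b)) (q (octFace i c)) := by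
    intro a b c hba hbc hac hw
    rcases hq.eq_of_mem_segment (octahedron_adj_octFace i hac) (mem_segment_iff_wbtw.2 hw)
      with h | h
    · exact hba (octFace_injective i h)
    · exact hbc (octFace_injective i h)
  rcases hcol'.wbtw_or_wbtw_or_wbtw with h | h | h
  · exact hfalse _ _ _ (by decide) (by decide) (by decide) h
  · exact hfalse _ _ _ (by decide) (by decide) (by decide) h
  · exact hfalse _ _ _ (by decide) (by decide) (by decide) h

theorem mem_interior_of_mem_faceTriangle {i : Fin 8} {a : Fin 6} (ha : ∀ k, octFace i k ≠ a)
    (h : q a ∈ faceTriangle q i) : q a ∈ interior (faceTriangle q i) := by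
  by_contra hint
  obtain ⟨k, hk⟩ := exists_mem_segment_of_mem_boundary (hq.affineIndependent_face i) h hint
  rcases hq.eq_of_mem_segment (octahedron_adj_octFace_add i k) hk with h | h
  · exact ha _ h.symm
  · exact ha _ h.symm

/-- If a face contains another vertex, then it contains all other vertices. -/
theorem mem_faceTriangle_of_mem {i : Fin 8} {a : Fin 6} (ha : ∀ k, octFace i k ≠ a)
    (h : q a ∈ faceTriangle q i) (b : Fin 6) : q b ∈ faceTriangle q i := by
  by_cases hb : ∀ k, octFace i k ≠ b
  · by_contra hbi
    have hab : a ≠ b := by rintro rfl; exact hbi h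
    -- Both `a` and `b` are on the opposite face, hence adjacent. Their edge would have to leave the
    -- triangle through a side with which it shares no endpoint.
    obtain ⟨z, hz, hz1, hz2⟩ := exists_mem_segment_boundary (isClosed_triangle _)
      (hq.mem_interior_of_mem_faceTriangle ha h) fun h' => hbi (interior_subset h')
    obtain ⟨k, hk⟩ := exists_mem_segment_of_mem_boundary (hq.affineIndependent_face i) hz1 hz2
    have hadj := octahedron_adj_octFace_add i k
    have hne : s(a, b) ≠ s(octFace i (k + 1), octFace i (k + 2)) := fun e => by
      rcases Sym2.mem_iff.1 (e ▸ Sym2.mem_mk_left a b) with h | h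
      · exact ha _ h.symm
      · exact ha _ h.symm
    obtain ⟨w, -, hw, hw'⟩ := hq.exists_common_of_mem (octahedron_adj_of_notMem i ha hb hab) hadj
      hne hz hk
    rcases hw with rfl | rfl <;> rcases hw' with hw' | hw'
    · exact ha _ hw'.symm
    · exact ha _ hw'.symm
    · exact hb _ hw'.symm
    · exact hb _ hw'.symm
  · push Not at hb
    obtain ⟨k, rfl⟩ := hb
    exact corner_mem_triangle (q ∘ octFace i) k

/-- An edge with no end in the interior of a face does not pass through the interior. -/
theorem segment_disjoint_interior {i : Fin 8} {u v : Fin 6} (huv : octahedron.Adj u v)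
    (hu : q u ∉ interior (faceTriangle q i)) (hv : q v ∉ interior (faceTriangle q i)) {y : Plane}
    (hy : y ∈ segment ℝ (q u) (q v)) : y ∉ interior (faceTriangle q i) := by
  intro hint
  -- Going from `y` to `u`, the edge meets a side of the triangle. Either it is that side or the
  -- meeting point is a common endpoint; both make `u` a corner. By symmetry `v` is a corner too,
  -- and segments between corners avoid the interior.
  have key : ∀ u v : Fin 6, octahedron.Adj u v → q u ∉ interior (faceTriangle q i) →
      q v ∉ interior (faceTriangle q i) → y ∈ segment ℝ (q u) (q v) → ∃ k, octFace i k = u := by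
    intro u v huv hu hv hy
    obtain ⟨z, hz, hz1, hz2⟩ := exists_mem_segment_boundary (isClosed_triangle _) hint hu
    obtain ⟨k, hk⟩ := exists_mem_segment_of_mem_boundary (hq.affineIndependent_face i) hz1 hz2
    have hadj := octahedron_adj_octFace_add i k
    by_cases he : s(u, v) = s(octFace i (k + 1), octFace i (k + 2))
    · rcases Sym2.mem_iff.1 (he ▸ Sym2.mem_mk_left u v) with h | h
      · exact ⟨_, h.symm⟩
      · exact ⟨_, h.symm⟩
    have hz' : z ∈ segment ℝ (q u) (q v) :=
      (convex_segment _ _).segment_subset hy (left_mem_segment ℝ _ _) hz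
    obtain ⟨w, hwz, hw, hw'⟩ := hq.exists_common_of_mem huv hadj he hz' hk
    -- The meeting point lies between `y` and `u`. If it were the far end `v`, then `y` would be
    -- `v`, which is not interior.
    have hwu : w = u := by
      rcases hw with hw | rfl
      · exact hw
      · exfalso
        subst hwz
        have h1 := mem_segment_iff_wbtw.1 hz
        have h2 := mem_segment_iff_wbtw.1 hy
        have h3 : y = q w := (Wbtw.swap_left_iff (R := ℝ) (z := q u) h1).1 h2.symm
        exact hv (h3 ▸ hint)
    subst hwu
    rcases hw' with h | h
    · exact ⟨_, h.symm⟩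
    · exact ⟨_, h.symm⟩
  obtain ⟨k, rfl⟩ := key u v huv hu hv hy
  obtain ⟨l, rfl⟩ := key v _ huv.symm hv hu (segment_symm ℝ (q _) (q v) ▸ hy)
  exact notMem_interior_of_mem_segment (hq.affineIndependent_face i) k l hy hint

open Classical in
/-- A point off the drawing lies in an even number of faces. -/
theorem sum_interior_faceTriangle {x : Plane}
    (hx : ∀ a b, octahedron.Adj a b → x ∉ segment ℝ (q a) (q b)) :
    ∑ i, (if x ∈ interior (faceTriangle q i) then 1 else 0 : ZMod 2) = 0 := by
  have h : ∀ i, (if x ∈ interior (faceTriangle q i) then 1 else 0 : ZMod 2) =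
      rayCrossing x (q (octFace i 0)) (q (octFace i 1)) +
      rayCrossing x (q (octFace i 1)) (q (octFace i 2)) +
      rayCrossing x (q (octFace i 2)) (q (octFace i 0)) := fun i =>
    interior_triangle_eq_rayCrossing (hq.affineIndependent_face i)
      fun k => hx _ _ (octahedron_adj_octFace_add i k)
  rw [Finset.sum_congr rfl fun i _ => h i]
  simp only [Fin.sum_univ_eight, octFace, Matrix.cons_val]
  -- Each of the twelve edges belongs to two faces. Once its two occurrences are written in the same
  -- direction, they cancel modulo 2.
  rw [rayCrossing_comm x (q 2) (q 0), rayCrossing_comm x (q 5) (q 0),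
    rayCrossing_comm x (q 2) (q 3), rayCrossing_comm x (q 5) (q 3),
    rayCrossing_comm x (q 3) (q 1), rayCrossing_comm x (q 3) (q 4)]
  ring_nf
  simp only [show (2 : ZMod 2) = 0 from rfl, mul_zero, add_zero]

theorem exists_ne_mem_interior {x : Plane}
    (hx : ∀ a b, octahedron.Adj a b → x ∉ segment ℝ (q a) (q b)) {o : Fin 8}
    (ho : x ∈ interior (faceTriangle q o)) : ∃ j, j ≠ o ∧ x ∈ interior (faceTriangle q j) := by
  classical
  by_contra! h
  have hsum := hq.sum_interior_faceTriangle hx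
  rw [Finset.sum_eq_single o (fun j _ hj => if_neg (h j hj)) (by simp), if_pos ho] at hsum
  exact absurd hsum (by decide)

/-- The outer face: one of the triangles contains all vertices. -/
theorem exists_outer : ∃ o, ∀ a, q a ∈ faceTriangle q o := by
  by_cases h0 : ∃ a, (∀ k, octFace 0 k ≠ a) ∧ q a ∈ faceTriangle q 0
  · obtain ⟨a, ha, ha'⟩ := h0
    exact ⟨0, hq.mem_faceTriangle_of_mem ha ha'⟩
  push Not at h0
  have hind := hq.affineIndependent_face 0
  -- As `x` avoids all edges, parity puts it into a second triangle `j`. No edge enters the interior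
  -- of triangle 0, so the sides of triangle `j` miss it, and triangle 0 lies in triangle `j`. A
  -- corner of face 0 that is not on face `j` then makes `j` the outer face.
  obtain ⟨x, hx, hxD⟩ := exists_mem_forall_notMem_segment
    (fun e : Fin 6 × Fin 6 => q e.1) (fun e => q e.2) (isOpen_interior (s := faceTriangle q 0))
    (interior_triangle_nonempty hind)
  obtain ⟨j, hj, hxj⟩ := hq.exists_ne_mem_interior (fun a b _ => hxD (a, b)) hx
  have hvert : ∀ a, q a ∉ interior (faceTriangle q 0) := by
    intro a hint
    by_cases ha : ∀ k, octFace 0 k ≠ a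
    · exact h0 a ha (interior_subset hint)
    · push Not at ha
      obtain ⟨k, rfl⟩ := ha
      exact corner_notMem_interior hind k hint
  have hsub : interior (faceTriangle q 0) ⊆ interior (faceTriangle q j) := by
    intro y hy
    by_contra hyj
    obtain ⟨z, hz, hz1, hz2⟩ := exists_mem_segment_boundary (isClosed_triangle _) hxj hyj
    have hz0 : z ∈ interior (faceTriangle q 0) :=
      (convex_convexHull ℝ _).interior.segment_subset hx hy hz
    obtain ⟨k, hk⟩ := exists_mem_segment_of_mem_boundary (hq.affineIndependent_face j) hz1 hz2
    exact hq.segment_disjoint_interior (octahedron_adj_octFace_add j k) (hvert _)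
      (hvert _) hk hz0
  have hsub' : faceTriangle q 0 ⊆ faceTriangle q j := by
    have hcl := (convex_convexHull ℝ
      (Set.range (q ∘ octFace 0))).closure_interior_eq_closure_of_nonempty_interior
      (interior_triangle_nonempty hind)
    rw [(isClosed_triangle _).closure_eq] at hcl
    rw [faceTriangle, ← hcl]
    exact closure_minimal (hsub.trans interior_subset) (isClosed_triangle _)
  obtain ⟨k, hk⟩ := exists_notMem_octFace hj.symm
  exact ⟨j, hq.mem_faceTriangle_of_mem hk (hsub' (corner_mem_triangle (q ∘ octFace 0) k))⟩

/-- Only one of the triangles contains all vertices. -/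
theorem outer_unique {o i : Fin 8} (ho : ∀ a, q a ∈ faceTriangle q o)
    (hi : ∀ a, q a ∈ faceTriangle q i) : i = o := by
  by_contra hne
  obtain ⟨k, hk⟩ := exists_notMem_octFace (Ne.symm hne)
  have h1 := hq.mem_interior_of_mem_faceTriangle hk (hi _)
  have h2 : faceTriangle q i ⊆ faceTriangle q o := by
    refine convexHull_min ?_ (convex_convexHull ℝ _)
    rintro _ ⟨l, rfl⟩
    exact ho _
  exact corner_notMem_interior (hq.affineIndependent_face o) k (interior_mono h2 h1)

theorem mem_octFace_of_mem_faceTriangle {o i : Fin 8} (ho : ∀ a, q a ∈ faceTriangle q o)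
    (hi : i ≠ o) {a : Fin 6} (ha : q a ∈ faceTriangle q i) : a ∈ Set.range (octFace i) := by
  by_contra h
  exact hi (hq.outer_unique ho
    (hq.mem_faceTriangle_of_mem (fun k hk => h ⟨k, hk⟩) ha))

end IsStraightLineEmbedding

/-! ### Straight-line embeddings of filled octahedra -/

namespace FillingData

variable {n : ℕ} {h6 : 6 ≤ n} {s s' : Fin 8 → ℕ} {T T' : SimpleGraph (Fin n)}
  {N N' : Fin 8 → Finset (Fin n)} {π π' : Fin n → Plane}

theorem octahedron_embedding (h : FillingData h6 s T N) (hπ : IsStraightLineEmbedding T π) :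
    IsStraightLineEmbedding octahedron (π ∘ Fin.castLE h6) := by
  have := hπ.comap (Fin.castLEEmb h6)
  rwa [show T.comap (Fin.castLEEmb h6) = octahedron from h.comap] at this

theorem adj_castLE (h : FillingData h6 s T N) {a b : Fin 6} (hab : octahedron.Adj a b) :
    T.Adj (Fin.castLE h6 a) (Fin.castLE h6 b) := by
  rw [← h.comap] at hab
  exact hab

theorem castLE_ne {v : Fin n} (hv : 6 ≤ v.val) (a : Fin 6) : v ≠ Fin.castLE h6 a := by
  rintro rfl
  simp only [Fin.val_castLE] at hv
  omega

theorem notMem_segment (h : FillingData h6 s T N) (hπ : IsStraightLineEmbedding T π) {v : Fin n}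
    (hv : 6 ≤ v.val) {a b : Fin 6} (hab : octahedron.Adj a b) :
    π v ∉ segment ℝ ((π ∘ Fin.castLE h6) a) ((π ∘ Fin.castLE h6) b) := by
  intro hmem
  rcases hπ.eq_of_mem_segment (h.adj_castLE hab) hmem with e | e
  · exact castLE_ne hv _ e
  · exact castLE_ne hv _ e

/-- The boundary consists of octahedron edges, which the edge `uv` can meet only in a common
endpoint; `u` is new and is not one. -/
theorem eq_of_mem_boundary (h : FillingData h6 s T N) (hπ : IsStraightLineEmbedding T π)
    {u v : Fin n} (hu : 6 ≤ u.val) (huv : T.Adj u v) {i : Fin 8} {z : Plane}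
    (hz : z ∈ segment ℝ (π u) (π v)) (hz1 : z ∈ faceTriangle (π ∘ Fin.castLE h6) i)
    (hz2 : z ∉ interior (faceTriangle (π ∘ Fin.castLE h6) i)) : z = π v := by
  have hq := h.octahedron_embedding hπ
  obtain ⟨k, hk⟩ := exists_mem_segment_of_mem_boundary (hq.affineIndependent_face i) hz1 hz2
  have hadj := h.adj_castLE (octahedron_adj_octFace_add i k)
  have hne : s(u, v) ≠ s(Fin.castLE h6 (octFace i (k + 1)), Fin.castLE h6 (octFace i (k + 2))) :=
    fun e => by
      rcases Sym2.mem_iff.1 (e ▸ Sym2.mem_mk_left u v) with e | e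
      · exact castLE_ne hu _ e
      · exact castLE_ne hu _ e
  obtain ⟨w, rfl, hw, hw'⟩ := hπ.exists_common_of_mem huv hadj hne hz hk
  rcases hw with rfl | rfl
  · rcases hw' with e | e
    · exact absurd e (castLE_ne hu _)
    · exact absurd e (castLE_ne hu _)
  · rfl

theorem notMem_boundary (h : FillingData h6 s T N) (hπ : IsStraightLineEmbedding T π)
    {v : Fin n} (hv : 6 ≤ v.val) {i : Fin 8} (hz1 : π v ∈ faceTriangle (π ∘ Fin.castLE h6) i) :
    π v ∈ interior (faceTriangle (π ∘ Fin.castLE h6) i) := by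
  by_contra hz2
  have hq := h.octahedron_embedding hπ
  obtain ⟨k, hk⟩ := exists_mem_segment_of_mem_boundary (hq.affineIndependent_face i) hz1 hz2
  exact h.notMem_segment hπ hv (octahedron_adj_octFace_add i k) hk

theorem mem_of_adj (h : FillingData h6 s T N) (hπ : IsStraightLineEmbedding T π)
    {u v : Fin n} (hu : 6 ≤ u.val) (huv : T.Adj u v) {i : Fin 8}
    (hint : π u ∈ interior (faceTriangle (π ∘ Fin.castLE h6) i)) :
    π v ∈ faceTriangle (π ∘ Fin.castLE h6) i := by
  by_contra hv
  obtain ⟨z, hz, hz1, hz2⟩ := exists_mem_segment_boundary (isClosed_triangle _) hint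
    fun h' => hv (interior_subset h')
  exact hv (h.eq_of_mem_boundary hπ hu huv hz hz1 hz2 ▸ hz1)

theorem mem_of_adj_interior (h : FillingData h6 s T N) (hπ : IsStraightLineEmbedding T π)
    {u v : Fin n} (hu : 6 ≤ u.val) (huv : T.Adj u v) {i : Fin 8}
    (hint : π v ∈ interior (faceTriangle (π ∘ Fin.castLE h6) i)) :
    π u ∈ interior (faceTriangle (π ∘ Fin.castLE h6) i) := by
  by_contra hv
  obtain ⟨z, hz, hz1, hz2⟩ := exists_mem_segment_boundary (isClosed_triangle _) hint hv
  rw [segment_symm] at hz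
  exact hz2 (h.eq_of_mem_boundary hπ hu huv hz hz1 hz2 ▸ hint)

/-- New vertices never lie on the boundary of a face triangle, so a path through them that starts
inside stays inside. Only its last vertex may be on the boundary. -/
theorem corner_mem_of_reachesVia (h : FillingData h6 s T N) (hπ : IsStraightLineEmbedding T π)
    {v c : Fin n} (hv : 6 ≤ v.val) (hc : ReachesVia T {w | 6 ≤ w.val} v c) {i : Fin 8}
    (hint : π v ∈ interior (faceTriangle (π ∘ Fin.castLE h6) i)) :
    π c ∈ faceTriangle (π ∘ Fin.castLE h6) i := by
  obtain ⟨w, hw, hwc⟩ := hc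
  have hw' : 6 ≤ w.val ∧ π w ∈ interior (faceTriangle (π ∘ Fin.castLE h6) i) := by
    clear hwc
    induction hw with
    | refl => exact ⟨hv, hint⟩
    | tail _ hab ih =>
      exact ⟨hab.2, h.notMem_boundary hπ hab.2 (h.mem_of_adj hπ ih.1 hab.1 ih.2)⟩
  exact h.mem_of_adj hπ hw'.1 hwc hw'.2

theorem mem_of_reachesVia_corner (h : FillingData h6 s T N) (hπ : IsStraightLineEmbedding T π)
    {v c : Fin n} (hv : 6 ≤ v.val) (hc : ReachesVia T {w | 6 ≤ w.val} v c) {i : Fin 8}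
    (hint : π c ∈ interior (faceTriangle (π ∘ Fin.castLE h6) i)) :
    π v ∈ interior (faceTriangle (π ∘ Fin.castLE h6) i) := by
  obtain ⟨w, hw, hwc⟩ := hc
  have hback : 6 ≤ w.val → π w ∈ interior (faceTriangle (π ∘ Fin.castLE h6) i) →
      π v ∈ interior (faceTriangle (π ∘ Fin.castLE h6) i) := by
    clear hwc
    induction hw using Relation.ReflTransGen.head_induction_on with
    | refl => exact fun _ h => h
    | head hab _ ih => exact fun h1 h2 => h.mem_of_adj_interior hπ hv hab.1 (ih hab.2 h1 h2)
  have hw6 : 6 ≤ w.val := by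
    rcases hw.cases_tail with rfl | ⟨_, -, hab⟩
    · exact hv
    · exact hab.2
  exact hback hw6 (h.mem_of_adj_interior hπ hw6 hwc hint)

/-- A new vertex that is drawn inside of an inner face belongs to this face. -/
theorem eq_of_mem_interior (h : FillingData h6 s T N) (hπ : IsStraightLineEmbedding T π)
    {o : Fin 8} (ho : ∀ a, (π ∘ Fin.castLE h6) a ∈ faceTriangle (π ∘ Fin.castLE h6) o)
    {v : Fin n} {i j : Fin 8} (hv : v ∈ N i) (hj : j ≠ o)
    (hint : π v ∈ interior (faceTriangle (π ∘ Fin.castLE h6) j)) : i = j :=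
  -- All corners of face `i` are drawn in triangle `j`, and an inner triangle contains no octahedron
  -- vertices besides its own corners.
  eq_of_octFace_subset fun k => (h.octahedron_embedding hπ).mem_octFace_of_mem_faceTriangle ho hj
    (h.corner_mem_of_reachesVia hπ (h.new i v hv) (h.reachesVia hv k) hint)

/-- The new vertices of an inner face are drawn inside of this face. -/
theorem mem_interior_of_mem (h : FillingData h6 s T N) (hπ : IsStraightLineEmbedding T π)
    {o : Fin 8} (ho : ∀ a, (π ∘ Fin.castLE h6) a ∈ faceTriangle (π ∘ Fin.castLE h6) o)
    {v : Fin n} {i : Fin 8} (hv : v ∈ N i) (hi : i ≠ o) :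
    π v ∈ interior (faceTriangle (π ∘ Fin.castLE h6) i) := by
  have hq := h.octahedron_embedding hπ
  have hv6 := h.new i v hv
  -- Some corner of face `i` is not on the outer face and hence lies inside the outer triangle. A
  -- path leads from it back to `v` without leaving, so `v` is inside as well. By parity `v` is in a
  -- second triangle, which can only be that of face `i`.
  obtain ⟨k, hk⟩ := exists_notMem_octFace hi
  have ho' : π v ∈ interior (faceTriangle (π ∘ Fin.castLE h6) o) :=
    h.mem_of_reachesVia_corner hπ hv6 (h.reachesVia hv k)
      (hq.mem_interior_of_mem_faceTriangle hk (ho _))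
  obtain ⟨j, hj, hint⟩ := hq.exists_ne_mem_interior
    (fun a b hab => h.notMem_segment hπ hv6 hab) ho'
  rwa [h.eq_of_mem_interior hπ ho hv hj hint]

/-- The outer face depends only on the positions of the octahedron vertices, so both drawings have
the same one. Lying in an inner triangle is a property of the point, and it identifies the face in
either drawing. -/
theorem index_eq_of_apply_eq (h : FillingData h6 s T N) (h' : FillingData h6 s' T' N')
    (hπ : IsStraightLineEmbedding T π) (hπ' : IsStraightLineEmbedding T' π')
    (heq : π ∘ Fin.castLE h6 = π' ∘ Fin.castLE h6) {v v' : Fin n} {i j : Fin 8} (hv : v ∈ N i)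
    (hv' : v' ∈ N' j) (hvv' : π v = π' v') : i = j := by
  obtain ⟨o, ho⟩ := (h.octahedron_embedding hπ).exists_outer
  have ho' := ho
  rw [heq] at ho'
  by_cases hi : i = o
  · by_cases hj : j = o
    · rw [hi, hj]
    · have := h'.mem_interior_of_mem hπ' ho' hv' hj
      rw [← hvv', ← heq] at this
      exact h.eq_of_mem_interior hπ ho hv hj this
  · have := h.mem_interior_of_mem hπ ho hv hi
    rw [hvv', heq] at this
    exact (h'.eq_of_mem_interior hπ' ho' hv' hi this).symm

/-- If two filled octahedra are drawn on the same point set such that the vertices of the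
octahedron have the same positions, then the numbers of new vertices in the faces agree. -/
theorem counts_eq_of_embedding (h : FillingData h6 s T N) (h' : FillingData h6 s' T' N')
    (hπ : IsStraightLineEmbedding T π) (hπ' : IsStraightLineEmbedding T' π')
    (heq : π ∘ Fin.castLE h6 = π' ∘ Fin.castLE h6) (hrange : Set.range π = Set.range π') :
    s = s' := by
  have key : ∀ {s s' : Fin 8 → ℕ} {T T' : SimpleGraph (Fin n)} {N N' : Fin 8 → Finset (Fin n)}
      {π π' : Fin n → Plane}, FillingData h6 s T N → FillingData h6 s' T' N' →
      IsStraightLineEmbedding T π → IsStraightLineEmbedding T' π' →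
      π ∘ Fin.castLE h6 = π' ∘ Fin.castLE h6 → Set.range π = Set.range π' → ∀ i, s i ≤ s' i := by
    intro s s' T T' N N' π π' h h' hπ hπ' heq hrange i
    rw [← h.card i, ← h'.card i, ← Finset.card_image_of_injective (N i) hπ.1,
      ← Finset.card_image_of_injective (N' i) hπ'.1]
    refine Finset.card_le_card fun x hx => ?_
    obtain ⟨v, hv, rfl⟩ := Finset.mem_image.1 hx
    obtain ⟨v', hv'⟩ : π v ∈ Set.range π' := hrange ▸ ⟨v, rfl⟩
    -- The octahedron vertices occupy the same points in both drawings, so the remaining points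
    -- carry new vertices in both.
    have hv6' : 6 ≤ v'.val := by
      by_contra! hlt
      have e : π' v' = π (Fin.castLE h6 ⟨v'.val, hlt⟩) :=
        (congrFun heq ⟨v'.val, hlt⟩).symm
      exact castLE_ne (h.new i v hv) _ (hπ.1 (hv'.symm.trans e))
    obtain ⟨j, hj, -⟩ := h'.unique v' hv6'
    have hij := h.index_eq_of_apply_eq h' hπ hπ' heq hv hj hv'.symm
    exact Finset.mem_image.2 ⟨v', hij ▸ hj, hv'⟩
  funext i
  exact le_antisymm (key h h' hπ hπ' heq hrange i)
    (key h' h hπ' hπ heq.symm hrange.symm i)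

end FillingData

/-! ### The conflict -/

/-- Pigeonhole on the injections `Fin 6 ↪ P`. Since `P` has exactly `n` points, each embedding has
all of `P` as its range. -/
theorem not_isSimultaneouslyEmbeddable {n : ℕ} (h6 : 6 ≤ n) {S : Finset (Fin 8 → ℕ)}
    (hS : n.descFactorial 6 < S.card) (T : (Fin 8 → ℕ) → SimpleGraph (Fin n))
    (hT : ∀ s ∈ S, IsFilledOctahedron h6 s (T s)) :
    ¬ IsSimultaneouslyEmbeddable (T '' (S : Set (Fin 8 → ℕ))) := by
  rintro ⟨P, hP, hemb⟩
  have hex : ∀ s : S, EmbedsStraightLineOn (T s) P := fun s => hemb _ ⟨s, s.2, rfl⟩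
  choose π hπ hπP using hex
  have hrange : ∀ s, Set.range (π s) = P := by
    intro s
    have h1 : Finset.univ.image (π s) = P := by
      refine Finset.eq_of_subset_of_card_le ?_ ?_
      · intro x hx
        obtain ⟨v, -, rfl⟩ := Finset.mem_image.1 hx
        exact hπP s v
      · rw [Finset.card_image_of_injective _ (hπ s).1, Finset.card_univ, Fintype.card_fin, hP]
    rw [← h1]
    simp
  let f : S → (Fin 6 ↪ P) := fun s =>
    ⟨fun a => ⟨π s (Fin.castLE h6 a), hπP s _⟩, fun a b hab =>
      Fin.castLE_injective h6 ((hπ s).1 (congrArg Subtype.val hab))⟩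
  have hcard : Fintype.card (Fin 6 ↪ P) < Fintype.card S := by
    rw [Fintype.card_embedding_eq, Fintype.card_coe, Fintype.card_coe, hP, Fintype.card_fin]
    exact hS
  obtain ⟨s, s', hne, hf⟩ := Fintype.exists_ne_map_eq_of_card_lt f hcard
  obtain ⟨N, hN⟩ := (isFilledOctahedron_iff h6 _ _).1 (hT s s.2)
  obtain ⟨N', hN'⟩ := (isFilledOctahedron_iff h6 _ _).1 (hT s' s'.2)
  refine hne (Subtype.ext (hN.counts_eq_of_embedding hN' (hπ s) (hπ s') ?_ ?_))
  · funext a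
    exact congrArg Subtype.val (DFunLike.congr_fun hf a)
  · rw [hrange, hrange]

/-! ### Planarity -/

/-- Three-dimensional Euclidean space. -/
abbrev Space : Type := EuclideanSpace ℝ (Fin 3)

/-- The vertices of the regular octahedron. -/
def octPoint (c : Fin 6) (k : Fin 3) : ℤ :=
  if c.val % 3 = k.val then (if c.val < 3 then 1 else -1) else 0

/-- The signs of the coordinates of the points in the `i`-th face of the regular octahedron. -/
def faceSign (i : Fin 8) (k : Fin 3) : ℤ := if (octFace i k).val < 3 then 1 else -1

theorem faceSign_mul_self (i : Fin 8) (k : Fin 3) : faceSign i k * faceSign i k = 1 := by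
  unfold faceSign
  split_ifs <;> rfl

theorem faceSign_mul_octPoint (i : Fin 8) (k l : Fin 3) :
    faceSign i k * octPoint (octFace i l) k = if k = l then 1 else 0 := by
  revert i k l
  decide

theorem exists_octFace_eq_of_nonneg {i : Fin 8} {c : Fin 6}
    (h : ∀ k, 0 ≤ faceSign i k * octPoint c k) : ∃ k, octFace i k = c := by
  revert i c
  decide

theorem exists_octFace_eq (c : Fin 6) : ∃ i k, octFace i k = c := by
  revert c
  decide

theorem faceSign_eq_or_eq_neg (i j : Fin 8) (k : Fin 3) :
    faceSign i k = faceSign j k ∨ faceSign i k = -faceSign j k := by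
  unfold faceSign
  split_ifs <;> simp

theorem faceSign_injective {i j : Fin 8} (h : ∀ k, faceSign i k = faceSign j k) : i = j := by
  revert i j
  decide

/-- The face of the regular octahedron in the orthant with the given signs. -/
def OnFace (i : Fin 8) (y : Space) : Prop :=
  (∀ k, 0 ≤ (faceSign i k : ℝ) * y k) ∧ ∑ k, (faceSign i k : ℝ) * y k = 1

theorem OnFace.sum_abs {i : Fin 8} {y : Space} (h : OnFace i y) : ∑ k, |y k| = 1 := by
  rw [← h.2]
  refine Finset.sum_congr rfl fun k _ => ?_
  rw [← abs_of_nonneg (h.1 k), abs_mul]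
  have : |(faceSign i k : ℝ)| = 1 := by
    unfold faceSign
    split_ifs <;> simp
  rw [this, one_mul]

theorem faceSign_mul_faceSign_mul (i : Fin 8) (k : Fin 3) (t : ℝ) :
    (faceSign i k : ℝ) * ((faceSign i k : ℝ) * t) = t := by
  rw [← mul_assoc]
  have : (faceSign i k : ℝ) * (faceSign i k : ℝ) = 1 := by exact_mod_cast faceSign_mul_self i k
  rw [this, one_mul]

theorem OnFace.eq_of_pos {i j : Fin 8} {y : Space} (hi : OnFace i y)
    (hj : ∀ k, 0 < (faceSign j k : ℝ) * y k) : j = i := by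
  refine faceSign_injective fun k => ?_
  rcases faceSign_eq_or_eq_neg j i k with h | h
  · exact h
  · have h1 := hi.1 k
    have h2 := hj k
    rw [h] at h2
    push_cast at h2
    linarith

/-- A straight-line drawing of a filled octahedron on the surface of the regular octahedron. -/
structure SurfaceDrawing {n : ℕ} (h6 : 6 ≤ n) (N : Fin 8 → Finset (Fin n)) (T : SimpleGraph (Fin n))
    (ρ : Fin 8 → Fin n → Plane) (K : Fin 8 → Geometry.SimplicialComplex ℝ Plane)
    (b : Fin 8 → AffineBasis (Fin 3) ℝ Plane) (Ψ : Fin n → Space) : Prop where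
  injOn : ∀ i, Set.InjOn (ρ i) (Set.range (Fin.castLE h6 ∘ octFace i) ∪ N i)
  mem_vertices : ∀ i, ∀ w ∈ Set.range (Fin.castLE h6 ∘ octFace i) ∪ (N i : Set (Fin n)),
    ρ i w ∈ (K i).vertices
  mem_faces : ∀ i, ∀ u ∈ Set.range (Fin.castLE h6 ∘ octFace i) ∪ (N i : Set (Fin n)),
    ∀ v ∈ Set.range (Fin.castLE h6 ∘ octFace i) ∪ (N i : Set (Fin n)),
    T.Adj u v → ({ρ i u, ρ i v} : Finset Plane) ∈ (K i).faces
  coord : ∀ i, ∀ w ∈ Set.range (Fin.castLE h6 ∘ octFace i) ∪ (N i : Set (Fin n)), ∀ k,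
    (faceSign i k : ℝ) * Ψ w k = (b i).coord k (ρ i w)
  nonneg : ∀ i, ∀ w ∈ Set.range (Fin.castLE h6 ∘ octFace i) ∪ (N i : Set (Fin n)), ∀ k,
    0 ≤ (b i).coord k (ρ i w)
  pos : ∀ i, ∀ w ∈ N i, ∀ k, 0 < (b i).coord k (ρ i w)
  corner : ∀ c k, Ψ (Fin.castLE h6 c) k = octPoint c k

/-- Barycentric coordinates, with the signs of an orthant, carry each planar triangulation affinely
onto a face of the regular octahedron. Every face lists its corners so that the `k`-th lies on the
`k`-th axis; hence the faces agree on shared corners. -/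
theorem FillingData.exists_surfaceDrawing {n : ℕ} {h6 : 6 ≤ n} {s : Fin 8 → ℕ}
    {T : SimpleGraph (Fin n)} {N : Fin 8 → Finset (Fin n)} (h : FillingData h6 s T N) :
    ∃ ρ K b Ψ, SurfaceDrawing h6 N T ρ K b Ψ := by
  classical
  choose ρ K hind hinj hint hspace hvert hadj using h.face
  choose f hf _ using h.unique
  set b : Fin 8 → AffineBasis (Fin 3) ℝ Plane := fun i => triangleBasis _ (hind i) with hb
  set Ψ : Fin n → Space := fun w => if hw : w.val < 6 then
      WithLp.toLp 2 (fun k => (octPoint ⟨w.val, hw⟩ k : ℝ))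
    else WithLp.toLp 2 (fun k => (faceSign (f w (not_lt.1 hw)) k : ℝ) *
      (b (f w (not_lt.1 hw))).coord k (ρ (f w (not_lt.1 hw)) w)) with hΨ
  have hcorner : ∀ c k, Ψ (Fin.castLE h6 c) k = octPoint c k := by
    intro c k
    simp [hΨ]
  have hpos : ∀ i, ∀ w ∈ N i, ∀ k, 0 < (b i).coord k (ρ i w) :=
    fun i w hw => (mem_interior_triangle _ (hind i) _).1 (hint i w hw)
  refine ⟨ρ, K, b, Ψ, ⟨hinj, fun i w hw => hvert i ▸ Set.mem_image_of_mem _ hw,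
    fun i u hu v hv huv => (hadj i u hu v hv huv.ne).1 huv, ?_, ?_, hpos, hcorner⟩⟩
  · rintro i w (⟨l, rfl⟩ | hw) k
    · rw [Function.comp_apply, hcorner]
      have h1 := coord_triangleBasis _ (hind i) k l
      simp only [Function.comp_apply] at h1
      rw [hb]
      simp only
      rw [h1]
      exact_mod_cast faceSign_mul_octPoint i k l
    · have hw6 := h.new i w hw
      have hfi : f w hw6 = i := h.eq_of_mem (hf w hw6) hw
      simp only [hΨ, dif_neg (not_lt.2 hw6), hfi]
      exact faceSign_mul_faceSign_mul i k _
  · rintro i w (⟨l, rfl⟩ | hw) k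
    · have h1 := coord_triangleBasis _ (hind i) k l
      simp only [Function.comp_apply] at h1 ⊢
      rw [hb]
      simp only
      rw [h1]
      split_ifs <;> norm_num
    · exact (hpos i w hw k).le

namespace SurfaceDrawing

theorem ext_coord {b : Fin 8 → AffineBasis (Fin 3) ℝ Plane} {i : Fin 8} {y : Space} {p q : Plane}
    (hp : ∀ k, (faceSign i k : ℝ) * y k = (b i).coord k p)
    (hq : ∀ k, (faceSign i k : ℝ) * y k = (b i).coord k q) : p = q :=
  (b i).ext_elem fun k => (hp k).symm.trans (hq k)

variable {n : ℕ} {h6 : 6 ≤ n} {s : Fin 8 → ℕ} {T : SimpleGraph (Fin n)}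
  {N : Fin 8 → Finset (Fin n)} {ρ : Fin 8 → Fin n → Plane}
  {K : Fin 8 → Geometry.SimplicialComplex ℝ Plane} {b : Fin 8 → AffineBasis (Fin 3) ℝ Plane}
  {Ψ : Fin n → Space} (D : SurfaceDrawing h6 N T ρ K b Ψ)
include D

theorem exists_mem_segment {i : Fin 8} {u v : Fin n}
    (hu : u ∈ Set.range (Fin.castLE h6 ∘ octFace i) ∪ (N i : Set (Fin n)))
    (hv : v ∈ Set.range (Fin.castLE h6 ∘ octFace i) ∪ (N i : Set (Fin n))) {y : Space}
    (hy : y ∈ segment ℝ (Ψ u) (Ψ v)) :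
    ∃ p ∈ segment ℝ (ρ i u) (ρ i v), ∀ k, (faceSign i k : ℝ) * y k = (b i).coord k p := by
  obtain ⟨α, β, hα, hβ, hαβ, rfl⟩ := hy
  refine ⟨_, ⟨α, β, hα, hβ, hαβ, rfl⟩, fun k => ?_⟩
  rw [Convex.combo_affine_apply hαβ, ← D.coord i u hu, ← D.coord i v hv]
  simp only [PiLp.add_apply, PiLp.smul_apply, smul_eq_mul]
  ring

theorem onFace_of_mem_segment {i : Fin 8} {u v : Fin n}
    (hu : u ∈ Set.range (Fin.castLE h6 ∘ octFace i) ∪ (N i : Set (Fin n)))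
    (hv : v ∈ Set.range (Fin.castLE h6 ∘ octFace i) ∪ (N i : Set (Fin n))) {y : Space}
    (hy : y ∈ segment ℝ (Ψ u) (Ψ v)) : OnFace i y := by
  obtain ⟨p, -, hp⟩ := D.exists_mem_segment hu hv hy
  constructor
  · intro k
    obtain ⟨α, β, hα, hβ, hαβ, rfl⟩ := hy
    have h1 := D.nonneg i u hu k
    have h2 := D.nonneg i v hv k
    rw [← D.coord i u hu] at h1
    rw [← D.coord i v hv] at h2
    simp only [PiLp.add_apply, PiLp.smul_apply, smul_eq_mul]
    have := add_nonneg (mul_nonneg hα h1) (mul_nonneg hβ h2)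
    linarith
  · rw [Finset.sum_congr rfl fun k _ => hp k]
    exact (b i).sum_coord_apply_eq_one p

theorem onFace {i : Fin 8} {u : Fin n}
    (hu : u ∈ Set.range (Fin.castLE h6 ∘ octFace i) ∪ (N i : Set (Fin n))) : OnFace i (Ψ u) :=
  D.onFace_of_mem_segment hu hu (left_mem_segment ℝ _ _)

/-- Pulled back to the plane of the face, the two edges are faces of a simplicial complex. They meet
in the hull of their common vertices, and distinct edges have at most one. -/
theorem exists_common_of_same_face {i : Fin 8} {u v u' v' : Fin n} (huv : T.Adj u v)
    (huv' : T.Adj u' v') (hne : s(u, v) ≠ s(u', v'))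
    (hu : u ∈ Set.range (Fin.castLE h6 ∘ octFace i) ∪ (N i : Set (Fin n)))
    (hv : v ∈ Set.range (Fin.castLE h6 ∘ octFace i) ∪ (N i : Set (Fin n)))
    (hu' : u' ∈ Set.range (Fin.castLE h6 ∘ octFace i) ∪ (N i : Set (Fin n)))
    (hv' : v' ∈ Set.range (Fin.castLE h6 ∘ octFace i) ∪ (N i : Set (Fin n))) {y : Space}
    (hy : y ∈ segment ℝ (Ψ u) (Ψ v)) (hy' : y ∈ segment ℝ (Ψ u') (Ψ v')) :
    y = Ψ u ∨ y = Ψ v := by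
  obtain ⟨p, hp, hpc⟩ := D.exists_mem_segment hu hv hy
  obtain ⟨p', hp', hpc'⟩ := D.exists_mem_segment hu' hv' hy'
  obtain rfl : p = p' := ext_coord hpc hpc'
  rw [← convexHull_pair] at hp hp'
  have hmem := (K i).inter_subset_convexHull (D.mem_faces i u hu v hv huv)
    (D.mem_faces i u' hu' v' hv' huv') ⟨by simpa using hp, by simpa using hp'⟩
  have hpt : ∀ w ∈ Set.range (Fin.castLE h6 ∘ octFace i) ∪ (N i : Set (Fin n)),
      p = ρ i w → y = Ψ w := by
    rintro w hw rfl
    ext k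
    have h1 := (hpc k).trans (D.coord i w hw k).symm
    rw [← faceSign_mul_faceSign_mul i k (y k), h1, faceSign_mul_faceSign_mul]
  by_cases h1 : ρ i u ∈ ({ρ i u', ρ i v'} : Finset Plane)
  · by_cases h2 : ρ i v ∈ ({ρ i u', ρ i v'} : Finset Plane)
    · exfalso
      rw [Finset.mem_insert, Finset.mem_singleton] at h1 h2
      have h1' : u = u' ∨ u = v' := h1.imp (D.injOn i hu hu') (D.injOn i hu hv')
      have h2' : v = u' ∨ v = v' := h2.imp (D.injOn i hv hu') (D.injOn i hv hv')
      have := huv.ne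
      rcases h1' with rfl | rfl <;> rcases h2' with rfl | rfl
      · exact this rfl
      · exact hne rfl
      · exact hne Sym2.eq_swap
      · exact this rfl
    · left
      refine hpt u hu ?_
      have hsub : (({ρ i u, ρ i v} : Finset Plane) ∩ ({ρ i u', ρ i v'} : Finset Plane) : Set Plane) ⊆
          {ρ i u} := by
        rintro x ⟨hx, hx'⟩
        rcases Finset.mem_insert.1 hx with rfl | hx
        · rfl
        · rw [Finset.mem_singleton.1 hx] at hx'
          exact absurd hx' h2
      simpa using convexHull_mono hsub hmem
  · right
    refine hpt v hv ?_
    have hsub : (({ρ i u, ρ i v} : Finset Plane) ∩ ({ρ i u', ρ i v'} : Finset Plane) : Set Plane) ⊆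
        {ρ i v} := by
      rintro x ⟨hx, hx'⟩
      rcases Finset.mem_insert.1 hx with rfl | hx
      · exact absurd hx' h1
      · exact Finset.mem_singleton.1 hx
    simpa using convexHull_mono hsub hmem

/-- This point becomes the centre of projection. It is taken in the relative interior of face 0,
where only segments within that face have to be avoided. -/
theorem exists_free_point : ∃ y₀ : Space, ∑ k, |y₀ k| = 1 ∧
    ∀ i, ∀ u ∈ Set.range (Fin.castLE h6 ∘ octFace i) ∪ (N i : Set (Fin n)),
      ∀ v ∈ Set.range (Fin.castLE h6 ∘ octFace i) ∪ (N i : Set (Fin n)),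
      y₀ ∉ segment ℝ (Ψ u) (Ψ v) := by
  have hpb : AffineIndependent ℝ (b 0) := (b 0).ind
  have hbasis : triangleBasis (b 0) hpb = b 0 := rfl
  obtain ⟨p, hp, hpseg⟩ := exists_mem_forall_notMem_segment
    (fun e : Fin n × Fin n => ρ 0 e.1) (fun e => ρ 0 e.2)
    (isOpen_interior (s := convexHull ℝ (Set.range (b 0)))) (interior_triangle_nonempty hpb)
  have hpos := (mem_interior_triangle _ hpb p).1 hp
  rw [hbasis] at hpos
  set y₀ : Space := WithLp.toLp 2 fun k => (faceSign 0 k : ℝ) * (b 0).coord k p with hy₀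
  have hc : ∀ k, (faceSign 0 k : ℝ) * y₀ k = (b 0).coord k p :=
    fun k => faceSign_mul_faceSign_mul 0 k _
  refine ⟨y₀, OnFace.sum_abs (i := 0) ⟨fun k => (hc k).symm ▸ (hpos k).le, ?_⟩, ?_⟩
  · rw [Finset.sum_congr rfl fun k _ => hc k]
    exact (b 0).sum_coord_apply_eq_one p
  · intro i u hu v hv hmem
    have hi : 0 = i := (D.onFace_of_mem_segment hu hv hmem).eq_of_pos
      fun k => (hc k).symm ▸ hpos k
    subst hi
    obtain ⟨q, hq, hqc⟩ := D.exists_mem_segment hu hv hmem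
    rw [ext_coord hqc hc] at hq
    exact hpseg (u, v) hq

end SurfaceDrawing

/-- The new vertices and the octahedron's vertices lie in faces. -/
theorem FillingData.exists_mem_union {n : ℕ} {h6 : 6 ≤ n} {s : Fin 8 → ℕ}
    {T : SimpleGraph (Fin n)} {N : Fin 8 → Finset (Fin n)} (h : FillingData h6 s T N) (w : Fin n) :
    ∃ i, w ∈ Set.range (Fin.castLE h6 ∘ octFace i) ∪ (N i : Set (Fin n)) := by
  by_cases hw : w.val < 6
  · obtain ⟨i, k, hk⟩ := exists_octFace_eq ⟨w.val, hw⟩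
    exact ⟨i, Or.inl ⟨k, by rw [Function.comp_apply, hk]; rfl⟩⟩
  · obtain ⟨i, hi, -⟩ := h.unique w (not_lt.1 hw)
    exact ⟨i, Or.inr hi⟩

namespace SurfaceDrawing

variable {n : ℕ} {h6 : 6 ≤ n} {s : Fin 8 → ℕ} {T : SimpleGraph (Fin n)}
  {N : Fin 8 → Finset (Fin n)} {ρ : Fin 8 → Fin n → Plane}
  {K : Fin 8 → Geometry.SimplicialComplex ℝ Plane} {b : Fin 8 → AffineBasis (Fin 3) ℝ Plane}
  {Ψ : Fin n → Space} (D : SurfaceDrawing h6 N T ρ K b Ψ) (h : FillingData h6 s T N)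
include D h

/-- A new vertex has no zero coordinate, so its orthant is unique; for octahedron vertices the claim
is a finite check. -/
theorem mem_of_onFace {i : Fin 8} {w : Fin n} (hw : OnFace i (Ψ w)) :
    w ∈ Set.range (Fin.castLE h6 ∘ octFace i) ∪ (N i : Set (Fin n)) := by
  by_cases hw6 : w.val < 6
  · have hwc : w = Fin.castLE h6 ⟨w.val, hw6⟩ := rfl
    obtain ⟨k, hk⟩ : ∃ k, octFace i k = ⟨w.val, hw6⟩ := by
      refine exists_octFace_eq_of_nonneg fun k => ?_
      have := hw.1 k
      rw [hwc, D.corner] at this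
      exact_mod_cast this
    exact Or.inl ⟨k, by rw [Function.comp_apply, hk]; rfl⟩
  · obtain ⟨j, hj, -⟩ := h.unique w (not_lt.1 hw6)
    have : j = i := hw.eq_of_pos fun k => by
      rw [D.coord j w (Or.inr hj)]
      exact D.pos j w hj k
    exact Or.inr (this ▸ hj)

theorem injective : Function.Injective Ψ := by
  intro w w' hww'
  obtain ⟨i, hi⟩ := h.exists_mem_union w
  have hi' := D.mem_of_onFace h (hww' ▸ D.onFace hi)
  refine D.injOn i hi hi' (ext_coord (D.coord i w hi) ?_)
  rw [hww']
  exact D.coord i w' hi'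

theorem eq_of_mem_segment {u v w : Fin n} (huv : T.Adj u v) (hw : Ψ w ∈ segment ℝ (Ψ u) (Ψ v)) :
    w = u ∨ w = v := by
  obtain ⟨i, hu, hv⟩ := h.adj u v huv
  have hwi := D.mem_of_onFace h (D.onFace_of_mem_segment hu hv hw)
  obtain ⟨p, hp, hpc⟩ := D.exists_mem_segment hu hv hw
  obtain rfl : p = ρ i w := ext_coord hpc (D.coord i w hwi)
  rw [← convexHull_pair] at hp
  have := ((K i).vertex_mem_convexHull_iff (D.mem_vertices i w hwi)
    (D.mem_faces i u hu v hv huv)).1 (by simpa using hp)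
  rcases Finset.mem_insert.1 this with e | e
  · exact Or.inl (D.injOn i hwi hu e)
  · exact Or.inr (D.injOn i hwi hv (Finset.mem_singleton.1 e))

/-- Suppose `y` is a proper interior point of `uv`. A coordinate whose sign differs between the
faces `i` and `j` vanishes at `y`. It does not change sign on face `i`, so it vanishes at `u` and
`v` too. Both ends thus lie on face `j`, and the one-face case applies. -/
theorem endpoint_of_mem_segments {u v u' v' : Fin n} (huv : T.Adj u v)
    (huv' : T.Adj u' v') (hne : s(u, v) ≠ s(u', v')) {y : Space}
    (hy : y ∈ segment ℝ (Ψ u) (Ψ v)) (hy' : y ∈ segment ℝ (Ψ u') (Ψ v')) :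
    y = Ψ u ∨ y = Ψ v := by
  obtain ⟨i, hu, hv⟩ := h.adj u v huv
  obtain ⟨j, hu', hv'⟩ := h.adj u' v' huv'
  by_contra hcon
  push Not at hcon
  have hyj := D.onFace_of_mem_segment hu' hv' hy'
  have hyi := D.onFace_of_mem_segment hu hv hy
  have hzero : ∀ k, faceSign i k ≠ faceSign j k → Ψ u k = 0 ∧ Ψ v k = 0 := by
    intro k hk
    have hneg := (faceSign_eq_or_eq_neg i j k).resolve_left hk
    have hyk : (faceSign i k : ℝ) * y k = 0 := by
      refine le_antisymm ?_ (hyi.1 k)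
      have := hyj.1 k
      rw [hneg]
      push_cast
      linarith
    have hu0 := (D.onFace hu).1 k
    have hv0 := (D.onFace hv).1 k
    obtain ⟨α, β, hα, hβ, hαβ, rfl⟩ := hy
    simp only [PiLp.add_apply, PiLp.smul_apply, smul_eq_mul] at hyk
    have hα0 : α ≠ 0 := by
      rintro rfl
      apply hcon.2
      rw [zero_add] at hαβ
      rw [hαβ]; simp
    have hβ0 : β ≠ 0 := by
      rintro rfl
      apply hcon.1
      rw [add_zero] at hαβ
      rw [hαβ]; simp
    have e1 := mul_nonneg hα hu0
    have e2 := mul_nonneg hβ hv0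
    have e3 : α * ((faceSign i k : ℝ) * Ψ u k) = 0 := by linarith
    have e4 : β * ((faceSign i k : ℝ) * Ψ v k) = 0 := by linarith
    have e5 := (mul_eq_zero.1 e3).resolve_left hα0
    have e6 := (mul_eq_zero.1 e4).resolve_left hβ0
    rw [← faceSign_mul_faceSign_mul i k (Ψ u k), ← faceSign_mul_faceSign_mul i k (Ψ v k), e5, e6]
    simp
  have htransfer : ∀ w, OnFace i (Ψ w) → (∀ k, faceSign i k ≠ faceSign j k → Ψ w k = 0) →
      OnFace j (Ψ w) := by
    intro w hw hz
    have he : ∀ k, (faceSign j k : ℝ) * Ψ w k = (faceSign i k : ℝ) * Ψ w k := by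
      intro k
      by_cases hk : faceSign i k = faceSign j k
      · rw [hk]
      · rw [hz k hk, mul_zero, mul_zero]
    exact ⟨fun k => (he k).symm ▸ hw.1 k, (Finset.sum_congr rfl fun k _ => he k).trans hw.2⟩
  have huj := D.mem_of_onFace h (htransfer u (D.onFace hu) fun k hk => (hzero k hk).1)
  have hvj := D.mem_of_onFace h (htransfer v (D.onFace hv) fun k hk => (hzero k hk).2)
  rcases D.exists_common_of_same_face huv huv' hne huj hvj hu' hv' hy hy' with e | e
  · exact hcon.1 e
  · exact hcon.2 e

end SurfaceDrawing

/-- On the surface the absolute coordinates sum to one, so their sum after normalization recovers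
the scaling factor. -/
theorem eq_of_normalize_eq {y z : Space} (hy : ∑ k, |y k| = 1) (hz : ∑ k, |z k| = 1)
    (hyz : ‖y‖⁻¹ • y = ‖z‖⁻¹ • z) : y = z := by
  have hne : ∀ {w : Space}, ∑ k, |w k| = 1 → w ≠ 0 := by
    rintro w hw rfl
    simp at hw
  have hy0 := norm_pos_iff.2 (hne hy)
  have hz0 := norm_pos_iff.2 (hne hz)
  have h1 : ∀ w : Space, ∑ k, |w k| = 1 → ∑ k, |(‖w‖⁻¹ • w) k| = ‖w‖⁻¹ := by
    intro w hw
    simp only [PiLp.smul_apply, smul_eq_mul, abs_mul]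
    rw [← Finset.mul_sum, hw, mul_one, abs_of_nonneg (by positivity)]
  have h2 : ‖y‖⁻¹ = ‖z‖⁻¹ := by rw [← h1 y hy, ← h1 z hz, hyz]
  rw [h2] at hyz
  exact smul_right_injective _ (inv_ne_zero hz0.ne') hyz

/-- The surface of the regular octahedron without a point embeds in the plane. -/
theorem exists_projection {y₀ : Space} (hy₀ : ∑ k, |y₀ k| = 1) :
    ∃ θ : Space → Plane, ContinuousOn θ {y | ∑ k, |y k| = 1 ∧ y ≠ y₀} ∧
      Set.InjOn θ {y | ∑ k, |y k| = 1 ∧ y ≠ y₀} := by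
  have hne : ∀ {w : Space}, ∑ k, |w k| = 1 → w ≠ 0 := by
    rintro w hw rfl
    simp at hw
  have hnorm : ∀ {w : Space}, ∑ k, |w k| = 1 → ‖‖w‖⁻¹ • w‖ = 1 := fun hw =>
    norm_smul_inv_norm (𝕜 := ℝ) (hne hw)
  set v : Space := ‖y₀‖⁻¹ • y₀ with hv
  have hv1 : ‖v‖ = 1 := hnorm hy₀
  have hv0 : v ≠ 0 := by
    intro h0
    rw [h0, norm_zero] at hv1
    exact zero_ne_one hv1
  have : Fact (Module.finrank ℝ Space = 2 + 1) := ⟨by simp⟩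
  let U := (OrthonormalBasis.fromOrthogonalSpanSingleton (𝕜 := ℝ) 2 hv0).repr
  -- Project centrally to the unit sphere, then stereographically from the image `v` of `y₀`, and
  -- identify the orthogonal complement of `v` with the plane by the isometry `U`.
  refine ⟨fun y => U (stereoToFun v (‖y‖⁻¹ • y)), ?_, ?_⟩
  · refine U.continuous.comp_continuousOn ?_
    refine (continuousOn_stereoToFun (v := v)).comp ?_ ?_
    · refine ContinuousOn.smul (ContinuousOn.inv₀ continuousOn_id.norm ?_) continuousOn_id
      exact fun y hy => (norm_pos_iff.2 (hne hy.1)).ne'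
    · rintro y ⟨hy, hyne⟩ hinner
      apply hyne
      refine eq_of_normalize_eq hy hy₀ ?_
      rw [innerSL_apply_apply] at hinner
      exact ((inner_eq_one_iff_of_norm_eq_one hv1 (hnorm hy)).1 hinner).symm
  · rintro y ⟨hy, hyne⟩ z ⟨hz, hzne⟩ hyz
    have h1 := U.injective hyz
    have hl : ∀ w : Space, (hw : ∑ k, |w k| = 1) → w ≠ y₀ →
        (stereoInvFun hv1 (stereoToFun v (‖w‖⁻¹ • w)) : Space) = ‖w‖⁻¹ • w := by
      intro w hw hwne
      have := stereo_left_inv hv1 (x := ⟨‖w‖⁻¹ • w, by simpa using hnorm hw⟩)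
        fun e => hwne (eq_of_normalize_eq hw hy₀ e)
      exact congrArg Subtype.val this
    refine eq_of_normalize_eq hy hz ?_
    rw [← hl y hy hyne, ← hl z hz hzne, h1]

/-- A filled octahedron is planar. -/
theorem IsFilledOctahedron.isPlanar {n : ℕ} {h6 : 6 ≤ n} {s : Fin 8 → ℕ}
    {T : SimpleGraph (Fin n)} (hT : IsFilledOctahedron h6 s T) : IsPlanar T := by
  obtain ⟨N, h⟩ := (isFilledOctahedron_iff h6 s T).1 hT
  obtain ⟨ρ, K, b, Ψ, D⟩ := h.exists_surfaceDrawing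
  obtain ⟨y₀, hy₀, hfree⟩ := D.exists_free_point
  obtain ⟨θ, hcont, hinj⟩ := exists_projection hy₀
  have hseg : ∀ u v, T.Adj u v →
      segment ℝ (Ψ u) (Ψ v) ⊆ {y | ∑ k, |y k| = 1 ∧ y ≠ y₀} := by
    intro u v huv y hy
    obtain ⟨i, hu, hv⟩ := h.adj u v huv
    refine ⟨(D.onFace_of_mem_segment hu hv hy).sum_abs, ?_⟩
    rintro rfl
    exact hfree i u hu v hv hy
  have hvert : ∀ w, Ψ w ∈ {y : Space | ∑ k, |y k| = 1 ∧ y ≠ y₀} := by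
    intro w
    obtain ⟨i, hw⟩ := h.exists_mem_union w
    refine ⟨(D.onFace hw).sum_abs, ?_⟩
    intro e
    exact hfree i w hw w hw (e ▸ left_mem_segment ℝ _ _)
  refine ⟨θ ∘ Ψ, fun e => θ '' (Sym2.lift ⟨fun u v => segment ℝ (Ψ u) (Ψ v),
    fun u v => segment_symm ℝ (Ψ u) (Ψ v)⟩ e), ?_, ?_, ⟨?_, ?_⟩⟩
  · intro u v huv
    exact D.injective h (hinj (hvert u) (hvert v) huv)
  · intro u v huv
    have hmem : ∀ t : unitInterval, AffineMap.lineMap (Ψ u) (Ψ v) (t : ℝ) ∈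
        segment ℝ (Ψ u) (Ψ v) := fun t => by
      rw [segment_eq_image_lineMap]
      exact Set.mem_image_of_mem _ t.2
    refine ⟨⟨⟨fun t => θ (AffineMap.lineMap (Ψ u) (Ψ v) (t : ℝ)), ?_⟩, by simp, by simp⟩, ?_, ?_⟩
    · refine hcont.comp_continuous ?_ fun t => hseg u v huv (hmem t)
      exact AffineMap.lineMap_continuous.comp continuous_subtype_val
    · intro t t' htt'
      have h1 := hinj (hseg u v huv (hmem t)) (hseg u v huv (hmem t')) htt'
      exact Subtype.ext (AffineMap.lineMap_injective ℝ
        (fun e => huv.ne (D.injective h e)) h1)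
    · simp only [Sym2.lift_mk]
      rw [segment_eq_image_lineMap, Set.image_image]
      ext x
      constructor
      · rintro ⟨t, rfl⟩
        exact ⟨t, t.2, rfl⟩
      · rintro ⟨t, ht, rfl⟩
        exact ⟨⟨t, ht⟩, rfl⟩
  · rintro ⟨u, v⟩ huv w ⟨y, hy, hyw⟩
    obtain rfl := hinj (hseg u v huv hy) (hvert w) hyw
    exact Sym2.mem_iff.2 (D.eq_of_mem_segment h huv hy)
  · rintro ⟨u, v⟩ huv ⟨u', v'⟩ huv' hne x ⟨⟨y, hy, rfl⟩, ⟨y', hy', hyy'⟩⟩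
    obtain rfl := hinj (hseg u' v' huv' hy') (hseg u v huv hy) hyy'
    rcases D.endpoint_of_mem_segments h huv huv' hne hy hy' with rfl | rfl
    · exact ⟨u, ⟨Sym2.mem_mk_left _ _, Sym2.mem_iff.2 (D.eq_of_mem_segment h huv' hy')⟩, rfl⟩
    · exact ⟨v, ⟨Sym2.mem_mk_right _ _, Sym2.mem_iff.2 (D.eq_of_mem_segment h huv' hy')⟩, rfl⟩

/-! ### Regular simplicial complexes -/

/-- The weighted values of `φ` are nonnegative with sum at most zero, so only points where `φ`
vanishes carry weight. -/
theorem mem_convexHull_filter_of_nonneg {E : Type*} [AddCommGroup E] [Module ℝ E]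
    {s : Finset E} {x : E} (hx : x ∈ convexHull ℝ (s : Set E)) (φ : E →ᵃ[ℝ] ℝ)
    (hφ : ∀ v ∈ s, 0 ≤ φ v) (hφx : φ x ≤ 0) :
    x ∈ convexHull ℝ {v | v ∈ s ∧ φ v = 0} := by
  classical
  obtain ⟨w, hw0, hw1, rfl⟩ := Finset.mem_convexHull'.1 hx
  have h1 : φ (∑ v ∈ s, w v • v) = ∑ v ∈ s, w v * φ v := by
    have := s.map_affineCombination id w hw1 φ
    rw [Finset.affineCombination_eq_linear_combination _ _ _ hw1,
      Finset.affineCombination_eq_linear_combination _ _ _ hw1] at this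
    simpa using this
  rw [h1] at hφx
  have h2 : ∀ v ∈ s, w v * φ v = 0 := by
    refine (Finset.sum_eq_zero_iff_of_nonneg fun v hv => mul_nonneg (hw0 v hv) (hφ v hv)).1 ?_
    exact le_antisymm hφx (Finset.sum_nonneg fun v hv => mul_nonneg (hw0 v hv) (hφ v hv))
  have h3 : {v | v ∈ s ∧ φ v = 0} = ((s.filter fun v => φ v = 0 : Finset E) : Set E) := by
    ext v; simp
  rw [h3, Finset.mem_convexHull']
  have h4 : ∀ v ∈ s, w v ≠ 0 → φ v = 0 := fun v hv hne => (mul_eq_zero.1 (h2 v hv)).resolve_left hne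
  refine ⟨w, fun v hv => hw0 v (Finset.mem_filter.1 hv).1, ?_, ?_⟩
  · rw [Finset.sum_filter_of_ne h4, hw1]
  · rw [Finset.sum_filter_of_ne]
    intro v hv hne
    exact h4 v hv fun h0 => hne (by rw [h0, zero_smul])

/-- A family of simplices that are the lower faces of a lifting `g` of the vertices form a
simplicial complex. -/
def regularComplex {E : Type*} [DecidableEq E] [AddCommGroup E] [Module ℝ E]
    (cells : Set (Finset E)) (g : E → ℝ)
    (hind : ∀ c ∈ cells, AffineIndependent ℝ ((↑) : c → E))
    (hlift : ∀ c ∈ cells, ∃ l : E →ᵃ[ℝ] ℝ, (∀ v ∈ c, l v = g v) ∧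
      ∀ d ∈ cells, ∀ v ∈ d, l v ≤ g v ∧ (l v = g v → v ∈ c)) :
    Geometry.SimplicialComplex ℝ E where
  faces := {s | s.Nonempty ∧ ∃ c ∈ cells, s ⊆ c}
  isRelLowerSet_faces := by
    rintro s ⟨hs, c, hc, hsc⟩
    exact ⟨hs, fun t hts ht => ⟨ht, c, hc, hts.trans hsc⟩⟩
  indep := by
    rintro s ⟨-, c, hc, hsc⟩
    exact (hind c hc).mono (t := (c : Set E)) (Finset.coe_subset.2 hsc)
  inter_subset_convexHull := by
    rintro s t ⟨-, c, hc, hsc⟩ ⟨-, d, hd, htd⟩ x ⟨hxs, hxt⟩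
    obtain ⟨l, hl, hl'⟩ := hlift c hc
    obtain ⟨m, hm, hm'⟩ := hlift d hd
    have h1 : l x ≤ m x := by
      have : convexHull ℝ (t : Set E) ⊆ (m - l) ⁻¹' Set.Ici 0 := by
        refine convexHull_min (fun v hv => ?_) ((convex_Ici 0).affine_preimage (m - l))
        have := (hl' d hd v (htd hv)).1
        rw [← hm v (htd hv)] at this
        exact sub_nonneg.2 this
      exact sub_nonneg.1 (this hxt)
    -- On `s` the function `l` equals `g` and dominates `m`, whereas `l x ≤ m x`. Hence `x` is
    -- spanned by vertices of `s` where `m = g`, and these lie in `d`. It remains to intersect two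
    -- faces of the single simplex `d`.
    have h2 := mem_convexHull_filter_of_nonneg hxs (l - m) (fun v hv => by
      have := (hm' c hc v (hsc hv)).1
      rw [← hl v (hsc hv)] at this
      exact sub_nonneg.2 this) (sub_nonpos.2 h1)
    have h3 : {v | v ∈ s ∧ (l - m) v = 0} ⊆ ((s ∩ d : Finset E) : Set E) := by
      rintro v ⟨hv, hv0⟩
      refine Finset.mem_coe.2 (Finset.mem_inter.2 ⟨hv, (hm' c hc v (hsc hv)).2 ?_⟩)
      rw [← hl v (hsc hv)]
      exact (sub_eq_zero.1 hv0).symm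
    have h4 := (hind d hd).convexHull_inter (t₁ := s ∩ d) (t₂ := t) Finset.inter_subset_right htd
    have h5 : x ∈ convexHull ℝ (((s ∩ d : Finset E) : Set E) ∩ t) := by
      rw [h4]
      exact ⟨convexHull_mono h3 h2, hxt⟩
    refine convexHull_mono ?_ h5
    rintro v ⟨hv, hv'⟩
    exact ⟨(Finset.mem_inter.1 (Finset.mem_coe.1 hv)).1, hv'⟩

theorem mem_convexHull_triple {E : Type*} [AddCommGroup E] [Module ℝ E] {A B C x : E} :
    x ∈ convexHull ℝ {A, B, C} ↔ ∃ α β γ : ℝ, 0 ≤ α ∧ 0 ≤ β ∧ 0 ≤ γ ∧ α + β + γ = 1 ∧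
      x = α • A + β • B + γ • C := by
  constructor
  · have hconv : Convex ℝ {x : E | ∃ α β γ : ℝ, 0 ≤ α ∧ 0 ≤ β ∧ 0 ≤ γ ∧ α + β + γ = 1 ∧
        x = α • A + β • B + γ • C} := by
      rintro x ⟨α, β, γ, hα, hβ, hγ, hs, rfl⟩ y ⟨α', β', γ', hα', hβ', hγ', hs', rfl⟩ a b ha hb hab
      refine ⟨a * α + b * α', a * β + b * β', a * γ + b * γ', by positivity, by positivity,
        by positivity, ?_, by module⟩
      linear_combination a * hs + b * hs' + hab
    refine fun hx => convexHull_min ?_ hconv hx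
    rintro v (rfl | rfl | rfl)
    · exact ⟨1, 0, 0, by simp⟩
    · exact ⟨0, 1, 0, by simp⟩
    · exact ⟨0, 0, 1, by simp⟩
  · rintro ⟨α, β, γ, hα, hβ, hγ, hs, rfl⟩
    refine mem_convexHull_of_exists_fintype ![α, β, γ] ![A, B, C] ?_ ?_ ?_ ?_
    · intro i; fin_cases i <;> assumption
    · simpa [Fin.sum_univ_three] using hs
    · intro i; fin_cases i <;> simp
    · simp [Fin.sum_univ_three]

/-- If `p` is in the interior of a triangle, then the triangle is covered by the three triangles
with a corner at `p`. -/
theorem mem_convexHull_stacked {E : Type*} [AddCommGroup E] [Module ℝ E] {A B C p x : E}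
    {a b c : ℝ} (ha : 0 < a) (hb : 0 < b) (hc : 0 < c) (hp : p = a • A + b • B + c • C)
    (hsum : a + b + c = 1) (hx : x ∈ convexHull ℝ {A, B, C}) :
    x ∈ convexHull ℝ {B, A, p} ∨ x ∈ convexHull ℝ {C, A, p} ∨ x ∈ convexHull ℝ {B, C, p} := by
  -- The smallest of the ratios `α / a`, `β / b`, `γ / c` selects the subtriangle and is the weight
  -- of `p` in it.
  have key : ∀ (A B C : E) (a b c α β γ : ℝ), 0 < a → p = a • A + b • B + c • C → 0 ≤ α →
      a + b + c = 1 → α + β + γ = 1 →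
      α / a ≤ β / b → α / a ≤ γ / c → 0 < b → 0 < c → x = α • A + β • B + γ • C →
      x ∈ convexHull ℝ {B, C, p} := by
    rintro A B C a b c α β γ ha rfl hα h1 h2 h3 h4 hb hc rfl
    rw [le_div_iff₀ hb] at h3
    rw [le_div_iff₀ hc] at h4
    have haa : α / a * a = α := div_mul_cancel₀ α ha.ne'
    rw [mem_convexHull_triple]
    refine ⟨β - α / a * b, γ - α / a * c, α / a, sub_nonneg.2 h3, sub_nonneg.2 h4,
      div_nonneg hα ha.le, ?_, ?_⟩
    · linear_combination h2 + haa - α / a * h1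
    · nth_rewrite 1 [← haa]
      module
  obtain ⟨α, β, γ, hα, hβ, hγ, hs, rfl⟩ := mem_convexHull_triple.1 hx
  rcases le_total (α / a) (β / b) with h1 | h1
  · rcases le_total (α / a) (γ / c) with h2 | h2
    · exact Or.inr (Or.inr (key A B C a b c α β γ ha hp hα hsum hs h1 h2 hb hc rfl))
    · left
      have := key C B A c b a γ β α hc (hp.trans (by module)) hγ (by linarith) (by linarith)
        (h2.trans h1) h2 hb ha (by module)
      exact this
  · rcases le_total (β / b) (γ / c) with h2 | h2
    · right; left
      exact key B C A b c a β γ α hb (hp.trans (by module)) hβ (by linarith) (by linarith)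
        h2 h1 hc ha (by module)
    · left
      exact key C B A c b a γ β α hc (hp.trans (by module)) hγ (by linarith) (by linarith)
        h2 (h2.trans h1) hb ha (by module)

/-! ### A triangulation with all new vertices on a line through a corner -/

theorem affineIndependent_of_orient_ne_zero {a b c : Plane} (h : orient a b c ≠ 0) :
    AffineIndependent ℝ ![a, b, c] := by
  rw [affineIndependent_iff_not_collinear_set]
  intro hcol
  obtain ⟨v, hv⟩ := (collinear_iff_of_mem (p₀ := c) (by simp)).1 hcol
  obtain ⟨r, hr⟩ := hv a (by simp)
  obtain ⟨r', hr'⟩ := hv b (by simp)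
  apply h
  rw [hr, hr']
  simp only [orient, vadd_eq_add, PiLp.add_apply, PiLp.smul_apply, smul_eq_mul]
  ring

theorem affineIndependent_finset {a b c : Plane} (h : orient a b c ≠ 0) :
    AffineIndependent ℝ ((↑) : ({a, b, c} : Finset Plane) → Plane) := by
  have h1 := (affineIndependent_of_orient_ne_zero h).range
  refine AffineIndependent.mono (s := (({a, b, c} : Finset Plane) : Set Plane)) h1 ?_
  intro x hx
  simp only [Finset.coe_insert, Finset.coe_singleton, Set.mem_insert_iff,
    Set.mem_singleton_iff] at hx
  rcases hx with rfl | rfl | rfl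
  · exact ⟨0, rfl⟩
  · exact ⟨1, rfl⟩
  · exact ⟨2, rfl⟩

/-- The height of the `j`-th point on the vertical line. -/
noncomputable def fanHeight (j : ℕ) : ℝ := 1 / (j + 1)

/-- The `j`-th point on the vertical line. -/
noncomputable def fanPoint (j : ℕ) : Plane := !₂[0, fanHeight j]

/-- The left corner. -/
noncomputable def fanLeft : Plane := !₂[-1, 0]

/-- The right corner. -/
noncomputable def fanRight : Plane := !₂[1, 0]

/-- All that matters about the heights is that they are positive, start at 1 and strictly decrease.
-/
theorem fanHeight_pos (j : ℕ) : 0 < fanHeight j := by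
  unfold fanHeight
  positivity

theorem fanHeight_zero : fanHeight 0 = 1 := by simp [fanHeight]

theorem fanHeight_lt {i j : ℕ} (h : i < j) : fanHeight j < fanHeight i := by
  unfold fanHeight
  have : (i : ℝ) < j := by exact_mod_cast h
  gcongr

theorem fanHeight_injective : Function.Injective fanHeight := by
  intro i j h
  rcases lt_trichotomy i j with hlt | rfl | hlt
  · exact absurd h (fanHeight_lt hlt).ne'
  · rfl
  · exact absurd h (fanHeight_lt hlt).ne

@[simp] theorem fanPoint_zero_coord (j : ℕ) : fanPoint j 0 = 0 := rfl
@[simp] theorem fanPoint_one_coord (j : ℕ) : fanPoint j 1 = fanHeight j := rfl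
@[simp] theorem fanLeft_zero_coord : fanLeft 0 = -1 := rfl
@[simp] theorem fanLeft_one_coord : fanLeft 1 = 0 := rfl
@[simp] theorem fanRight_zero_coord : fanRight 0 = 1 := rfl
@[simp] theorem fanRight_one_coord : fanRight 1 = 0 := rfl

theorem fanPoint_injective : Function.Injective fanPoint := fun _ _ h =>
  fanHeight_injective (congrArg (fun p : Plane => p 1) h)

theorem fanPoint_ne_fanLeft (j : ℕ) : fanPoint j ≠ fanLeft := fun h => by
  have := congrArg (fun p : Plane => p 0) h
  simp at this

theorem fanPoint_ne_fanRight (j : ℕ) : fanPoint j ≠ fanRight := fun h => by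
  have := congrArg (fun p : Plane => p 0) h
  simp at this

theorem fanLeft_ne_fanRight : fanLeft ≠ fanRight := fun h => by
  have := congrArg (fun p : Plane => p 0) h
  norm_num at this

/-- The triangles of the triangulation. -/
inductive IsFanCell (k : ℕ) : Finset Plane → Prop
  | left (j : ℕ) (h : j < k) : IsFanCell k {fanLeft, fanPoint j, fanPoint (j + 1)}
  | right (j : ℕ) (h : j < k) : IsFanCell k {fanRight, fanPoint j, fanPoint (j + 1)}
  | bottom : IsFanCell k {fanLeft, fanRight, fanPoint k}

theorem IsFanCell.mem_cases {k : ℕ} {c : Finset Plane} (hc : IsFanCell k c) {v : Plane}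
    (hv : v ∈ c) : v = fanLeft ∨ v = fanRight ∨ ∃ j ≤ k, v = fanPoint j := by
  cases hc with
  | left j h =>
    simp only [Finset.mem_insert, Finset.mem_singleton] at hv
    rcases hv with rfl | rfl | rfl
    · exact Or.inl rfl
    · exact Or.inr (Or.inr ⟨j, h.le, rfl⟩)
    · exact Or.inr (Or.inr ⟨j + 1, h, rfl⟩)
  | right j h =>
    simp only [Finset.mem_insert, Finset.mem_singleton] at hv
    rcases hv with rfl | rfl | rfl
    · exact Or.inr (Or.inl rfl)
    · exact Or.inr (Or.inr ⟨j, h.le, rfl⟩)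
    · exact Or.inr (Or.inr ⟨j + 1, h, rfl⟩)
  | bottom =>
    simp only [Finset.mem_insert, Finset.mem_singleton] at hv
    rcases hv with rfl | rfl | rfl
    · exact Or.inl rfl
    · exact Or.inr (Or.inl rfl)
    · exact Or.inr (Or.inr ⟨k, le_rfl, rfl⟩)

theorem IsFanCell.affineIndependent {k : ℕ} {c : Finset Plane} (hc : IsFanCell k c) :
    AffineIndependent ℝ ((↑) : c → Plane) := by
  cases hc with
  | left j h =>
    refine affineIndependent_finset ?_
    have := fanHeight_lt j.lt_succ_self
    simp [orient]
    linarith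
  | right j h =>
    refine affineIndependent_finset ?_
    have := fanHeight_lt j.lt_succ_self
    simp [orient]
    linarith
  | bottom =>
    refine affineIndependent_finset ?_
    have := fanHeight_pos k
    simp [orient]
    linarith

/-- The affine function with the given coefficients. -/
noncomputable def planeAffine (a b c : ℝ) : Plane →ᵃ[ℝ] ℝ :=
  (a • (EuclideanSpace.proj 0 : Plane →L[ℝ] ℝ) +
    b • (EuclideanSpace.proj 1 : Plane →L[ℝ] ℝ)).toLinearMap.toAffineMap + AffineMap.const ℝ _ c

theorem planeAffine_apply (a b c : ℝ) (v : Plane) :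
    planeAffine a b c v = a * v 0 + b * v 1 + c := by
  simp [planeAffine]

/-- No height lies strictly between two consecutive ones. So the square function is nowhere below
its chord through two consecutive heights, when evaluated at heights of the sequence. -/
theorem fanHeight_mul_nonneg (i j : ℕ) :
    0 ≤ (fanHeight i - fanHeight j) * (fanHeight i - fanHeight (j + 1)) := by
  rcases le_or_gt i j with h | h
  · have h1 : fanHeight j ≤ fanHeight i := by
      rcases h.eq_or_lt with rfl | h
      · exact le_rfl
      · exact (fanHeight_lt h).le
    have h2 := fanHeight_lt (Nat.lt_succ_of_le h)
    exact mul_nonneg (sub_nonneg.2 h1) (sub_nonneg.2 h2.le)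
  · have h1 : fanHeight i ≤ fanHeight (j + 1) := by
      rcases (Nat.succ_le_of_lt h).eq_or_lt with h | h
      · exact (congrArg fanHeight h).ge
      · exact (fanHeight_lt h).le
    have h2 := fanHeight_lt h
    exact mul_nonneg_of_nonpos_of_nonpos (sub_nonpos.2 h2.le) (sub_nonpos.2 h1)

/-- The points are lifted by the square of the height. For a left or right cell, `l` is the chord
through its two heights along the vertical line, tilted horizontally so as to vanish at the corner
of the cell; it is then negative at the opposite corner. For the bottom cell, `l` is the height
times `fanHeight k`. -/
theorem IsFanCell.exists_lift {k : ℕ} {c : Finset Plane} (hc : IsFanCell k c) :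
    ∃ l : Plane →ᵃ[ℝ] ℝ, (∀ v ∈ c, l v = (v 1) ^ 2) ∧
      ∀ d, IsFanCell k d → ∀ v ∈ d, l v ≤ (v 1) ^ 2 ∧ (l v = (v 1) ^ 2 → v ∈ c) := by
  cases hc with
  | left j h =>
    have p1 := mul_pos (fanHeight_pos j) (fanHeight_pos (j + 1))
    refine ⟨planeAffine (-(fanHeight j * fanHeight (j + 1))) (fanHeight j + fanHeight (j + 1))
      (-(fanHeight j * fanHeight (j + 1))), ?_, ?_⟩
    · intro v hv
      simp only [Finset.mem_insert, Finset.mem_singleton] at hv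
      rcases hv with rfl | rfl | rfl <;> simp [planeAffine_apply] <;> ring
    · intro d hd v hv
      rcases hd.mem_cases hv with rfl | rfl | ⟨i, -, rfl⟩
      · simp [planeAffine_apply]
      · simp only [planeAffine_apply, fanRight_zero_coord, fanRight_one_coord]
        constructor
        · nlinarith
        · intro h0; exfalso; nlinarith
      · have := fanHeight_mul_nonneg i j
        simp only [planeAffine_apply, fanPoint_zero_coord, fanPoint_one_coord]
        constructor
        · nlinarith
        · intro h0
          have h1 : (fanHeight i - fanHeight j) * (fanHeight i - fanHeight (j + 1)) = 0 := by
            linarith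
          rcases mul_eq_zero.1 h1 with h1 | h1
          · rw [fanHeight_injective (sub_eq_zero.1 h1)]; simp
          · rw [fanHeight_injective (sub_eq_zero.1 h1)]; simp
  | right j h =>
    have p1 := mul_pos (fanHeight_pos j) (fanHeight_pos (j + 1))
    refine ⟨planeAffine (fanHeight j * fanHeight (j + 1)) (fanHeight j + fanHeight (j + 1))
      (-(fanHeight j * fanHeight (j + 1))), ?_, ?_⟩
    · intro v hv
      simp only [Finset.mem_insert, Finset.mem_singleton] at hv
      rcases hv with rfl | rfl | rfl <;> simp [planeAffine_apply] <;> ring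
    · intro d hd v hv
      rcases hd.mem_cases hv with rfl | rfl | ⟨i, -, rfl⟩
      · simp only [planeAffine_apply, fanLeft_zero_coord, fanLeft_one_coord]
        constructor
        · nlinarith
        · intro h0; exfalso; nlinarith
      · simp [planeAffine_apply]
      · have := fanHeight_mul_nonneg i j
        simp only [planeAffine_apply, fanPoint_zero_coord, fanPoint_one_coord]
        constructor
        · nlinarith
        · intro h0
          have h1 : (fanHeight i - fanHeight j) * (fanHeight i - fanHeight (j + 1)) = 0 := by
            linarith
          rcases mul_eq_zero.1 h1 with h1 | h1
          · rw [fanHeight_injective (sub_eq_zero.1 h1)]; simp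
          · rw [fanHeight_injective (sub_eq_zero.1 h1)]; simp
  | bottom =>
    refine ⟨planeAffine 0 (fanHeight k) 0, ?_, ?_⟩
    · intro v hv
      simp only [Finset.mem_insert, Finset.mem_singleton] at hv
      rcases hv with rfl | rfl | rfl <;> simp [planeAffine_apply]
      ring
    · intro d hd v hv
      rcases hd.mem_cases hv with rfl | rfl | ⟨i, hi, rfl⟩
      · simp [planeAffine_apply]
      · simp [planeAffine_apply]
      · have hpos := fanHeight_pos i
        simp only [planeAffine_apply, fanPoint_zero_coord, fanPoint_one_coord]
        rcases hi.eq_or_lt with rfl | hlt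
        · exact ⟨by linarith [sq (fanHeight i)], fun _ => by simp⟩
        · have hlt' := mul_lt_mul_of_pos_right (fanHeight_lt hlt) hpos
          exact ⟨by linarith [sq (fanHeight i)], fun h0 => by linarith [sq (fanHeight i)]⟩

/-- The triangulation of a triangle with `k` new vertices on a line through a corner, all of which
are adjacent to the two other corners. -/
noncomputable def fanComplex (k : ℕ) : Geometry.SimplicialComplex ℝ Plane :=
  regularComplex {c | IsFanCell k c} (fun v => (v 1) ^ 2) (fun _ hc => hc.affineIndependent)
    fun _ hc => hc.exists_lift

theorem mem_fanComplex_faces {k : ℕ} {s : Finset Plane} :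
    s ∈ (fanComplex k).faces ↔ s.Nonempty ∧ ∃ c, IsFanCell k c ∧ s ⊆ c := Iff.rfl

theorem exists_isFanCell_fanPoint {k j : ℕ} (h : j ≤ k) :
    (∃ c, IsFanCell k c ∧ fanPoint j ∈ c ∧ fanLeft ∈ c) ∧
      ∃ c, IsFanCell k c ∧ fanPoint j ∈ c ∧ fanRight ∈ c := by
  rcases h.eq_or_lt with rfl | h
  · exact ⟨⟨_, IsFanCell.bottom, by simp, by simp⟩, ⟨_, IsFanCell.bottom, by simp, by simp⟩⟩
  · exact ⟨⟨_, IsFanCell.left j h, by simp, by simp⟩, ⟨_, IsFanCell.right j h, by simp, by simp⟩⟩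

theorem pair_mem_fanComplex_faces {k : ℕ} {a b : Plane} :
    ({a, b} : Finset Plane) ∈ (fanComplex k).faces ↔ ∃ c, IsFanCell k c ∧ a ∈ c ∧ b ∈ c := by
  rw [mem_fanComplex_faces]
  simp [Finset.insert_subset_iff]

theorem fanPoint_pair_mem_faces {k i j : ℕ} (hij : i < j) (hj : j ≤ k) :
    ({fanPoint i, fanPoint j} : Finset Plane) ∈ (fanComplex k).faces ↔ j = i + 1 := by
  rw [pair_mem_fanComplex_faces]
  constructor
  · rintro ⟨c, hc, h1, h2⟩
    cases hc <;> simp only [Finset.mem_insert, Finset.mem_singleton, fanPoint_ne_fanLeft,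
      fanPoint_ne_fanRight, fanPoint_injective.eq_iff, false_or] at h1 h2 <;> omega
  · rintro rfl
    exact ⟨_, IsFanCell.left i (by omega), by simp, by simp⟩

theorem fanComplex_vertices (k : ℕ) :
    (fanComplex k).vertices = {v | v = fanLeft ∨ v = fanRight ∨ ∃ j ≤ k, v = fanPoint j} := by
  ext v
  rw [Geometry.SimplicialComplex.mem_vertices, mem_fanComplex_faces]
  constructor
  · rintro ⟨-, c, hc, hv⟩
    exact hc.mem_cases (Finset.singleton_subset_iff.1 hv)
  · intro hv
    refine ⟨Finset.singleton_nonempty _, ?_⟩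
    simp only [Finset.singleton_subset_iff]
    rcases hv with rfl | rfl | ⟨j, hj, rfl⟩
    · exact ⟨_, IsFanCell.bottom, by simp⟩
    · exact ⟨_, IsFanCell.bottom, by simp⟩
    · obtain ⟨⟨c, hc, hjc, -⟩, -⟩ := exists_isFanCell_fanPoint hj
      exact ⟨c, hc, hjc⟩

theorem fanPoint_eq_combination (i j : ℕ) : fanPoint j =
    (fanHeight j / fanHeight i) • fanPoint i + ((1 - fanHeight j / fanHeight i) / 2) • fanLeft +
      ((1 - fanHeight j / fanHeight i) / 2) • fanRight := by
  have := (fanHeight_pos i).ne'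
  ext m
  fin_cases m
  · simp
  · simp [this]

/-- Coverage is shown from the lowest apex upwards: raising the apex by one point splits the new
triangle into a left cell, a right cell and the triangle already covered. -/
theorem fanComplex_space (k : ℕ) :
    (fanComplex k).space = convexHull ℝ {fanPoint 0, fanLeft, fanRight} := by
  apply Set.Subset.antisymm
  · intro x hx
    obtain ⟨s, hs, hxs⟩ := Geometry.SimplicialComplex.mem_space_iff.1 hx
    refine convexHull_min ?_ (convex_convexHull ℝ _) hxs
    intro v hv
    obtain ⟨-, c, hc, hsc⟩ := mem_fanComplex_faces.1 hs
    rcases hc.mem_cases (hsc hv) with rfl | rfl | ⟨j, hj, rfl⟩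
    · exact subset_convexHull ℝ _ (by simp)
    · exact subset_convexHull ℝ _ (by simp)
    · rw [mem_convexHull_triple]
      have h1 : fanHeight j ≤ 1 := by
        rw [← fanHeight_zero]
        rcases j.eq_zero_or_pos with rfl | h
        · exact le_rfl
        · exact (fanHeight_lt h).le
      have h2 := fanHeight_pos j
      refine ⟨_, _, _, ?_, ?_, ?_, ?_, fanPoint_eq_combination 0 j⟩ <;>
        rw [fanHeight_zero, div_one] <;> linarith
  · have hcell : ∀ c, IsFanCell k c → convexHull ℝ (c : Set Plane) ⊆ (fanComplex k).space := by
      intro c hc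
      refine Geometry.SimplicialComplex.convexHull_subset_space (mem_fanComplex_faces.2 ⟨?_, c, hc,
        subset_rfl⟩)
      cases hc <;> simp
    have key : ∀ m ≤ k, convexHull ℝ {fanPoint (k - m), fanLeft, fanRight} ⊆
        (fanComplex k).space := by
      intro m
      induction m with
      | zero =>
        intro _
        refine subset_trans ?_ (hcell _ IsFanCell.bottom)
        refine convexHull_mono ?_
        intro v hv
        simp only [Nat.sub_zero, Set.mem_insert_iff, Set.mem_singleton_iff] at hv
        simp only [Finset.coe_insert, Finset.coe_singleton, Set.mem_insert_iff,
          Set.mem_singleton_iff]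
        tauto
      | succ m ih =>
        intro hm x hx
        obtain ⟨j, hj⟩ : ∃ j, j = k - (m + 1) := ⟨_, rfl⟩
        have hjk : j < k := by omega
        rw [← hj] at hx
        have ih' := ih (by omega)
        rw [show k - m = j + 1 by omega] at ih'
        have h1 : fanHeight (j + 1) / fanHeight j < 1 :=
          (div_lt_one (fanHeight_pos j)).2 (fanHeight_lt j.lt_succ_self)
        rcases mem_convexHull_stacked (div_pos (fanHeight_pos (j + 1)) (fanHeight_pos j))
          (by linarith) (by linarith) (fanPoint_eq_combination j (j + 1)) (by ring) hx with h | h | h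
        · exact hcell _ (IsFanCell.left j hjk) (by simpa using h)
        · exact hcell _ (IsFanCell.right j hjk) (by simpa using h)
        · refine ih' (convexHull_mono ?_ h)
          intro v hv
          simp only [Set.mem_insert_iff, Set.mem_singleton_iff] at hv ⊢
          tauto
    simpa using key k le_rfl

theorem fanTriangle_affineIndependent :
    AffineIndependent ℝ ![fanPoint 0, fanLeft, fanRight] := by
  refine affineIndependent_of_orient_ne_zero ?_
  simp [orient, fanHeight_zero]

theorem fanPoint_mem_interior {j : ℕ} (hj : 0 < j) :
    fanPoint j ∈ interior (convexHull ℝ (Set.range ![fanPoint 0, fanLeft, fanRight])) := by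
  rw [mem_interior_triangle _ fanTriangle_affineIndependent]
  have h1 := fanHeight_lt hj
  have h2 := fanHeight_pos j
  rw [fanHeight_zero] at h1
  intro k
  have h := orient_eq_coord_mul fanTriangle_affineIndependent (fanPoint j) k
  have hpos : 0 < orient (![fanPoint 0, fanLeft, fanRight] (k + 1))
      (![fanPoint 0, fanLeft, fanRight] (k + 2)) (fanPoint j) := by
    fin_cases k <;> simp [orient, fanHeight_zero] <;> linarith
  have hΔ : 0 < orient (![fanPoint 0, fanLeft, fanRight] 0) (![fanPoint 0, fanLeft, fanRight] 1)
      (![fanPoint 0, fanLeft, fanRight] 2) := by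
    simp [orient, fanHeight_zero]
  rw [h] at hpos
  exact (pos_iff_pos_of_mul_pos hpos).2 hΔ

/-- A graph-theoretic description of the triangulation. -/
theorem isTriangulatedFace_fan {V : Type*} {T : SimpleGraph V} {corner : Fin 3 → V} {k : ℕ}
    (pt : ℕ → V) (idx : V → ℕ) (hidx : ∀ j ≤ k, idx (pt j) = j) (hpt : pt 0 = corner 0)
    (h12 : corner 1 ≠ corner 2) (hpt1 : ∀ j ≤ k, pt j ≠ corner 1) (hpt2 : ∀ j ≤ k, pt j ≠ corner 2)
    (hadj12 : T.Adj (corner 1) (corner 2)) (hadj1 : ∀ j ≤ k, T.Adj (pt j) (corner 1))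
    (hadj2 : ∀ j ≤ k, T.Adj (pt j) (corner 2))
    (hadj : ∀ i j, i < j → j ≤ k → (T.Adj (pt i) (pt j) ↔ j = i + 1)) {N : Set V}
    (hN : N = {v | ∃ j, 0 < j ∧ j ≤ k ∧ v = pt j}) : IsTriangulatedFace T corner N := by
  classical
  -- Since `pt 0` is corner 0, the apex and the new vertices form one sequence on the vertical line.
  -- Values of `ρ` at vertices outside this face are irrelevant.
  set ρ : V → Plane := fun v => if v = corner 1 then fanLeft else if v = corner 2 then fanRight
    else fanPoint (idx v) with hρ
  have ρ1 : ρ (corner 1) = fanLeft := if_pos rfl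
  have ρ2 : ρ (corner 2) = fanRight := by
    exact (if_neg h12.symm).trans (if_pos rfl)
  have ρp : ∀ j ≤ k, ρ (pt j) = fanPoint j := by
    intro j hj
    exact (if_neg (hpt1 j hj)).trans ((if_neg (hpt2 j hj)).trans (by rw [hidx j hj]))
  have hcorner : ρ ∘ corner = ![fanPoint 0, fanLeft, fanRight] := by
    funext l
    fin_cases l
    · simp [← hpt, ρp 0 (Nat.zero_le k)]
    · simp [ρ1]
    · simp [ρ2]
  have hU : ∀ v, v ∈ Set.range corner ∪ N ↔ v = corner 1 ∨ v = corner 2 ∨ ∃ j ≤ k, v = pt j := by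
    intro v
    rw [hN]
    constructor
    · rintro (⟨l, rfl⟩ | ⟨j, -, hj, rfl⟩)
      · fin_cases l
        · exact Or.inr (Or.inr ⟨0, Nat.zero_le k, hpt.symm⟩)
        · exact Or.inl rfl
        · exact Or.inr (Or.inl rfl)
      · exact Or.inr (Or.inr ⟨j, hj, rfl⟩)
    · rintro (rfl | rfl | ⟨j, hj, rfl⟩)
      · exact Or.inl ⟨1, rfl⟩
      · exact Or.inl ⟨2, rfl⟩
      · rcases j.eq_zero_or_pos with rfl | h
        · exact Or.inl ⟨0, hpt.symm⟩
        · exact Or.inr ⟨j, h, hj, rfl⟩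
  refine ⟨ρ, fanComplex k, hcorner ▸ fanTriangle_affineIndependent, ?_, ?_, ?_, ?_, ?_⟩
  · intro u hu v hv huv
    rcases (hU u).1 hu with rfl | rfl | ⟨i, hi, rfl⟩ <;>
      rcases (hU v).1 hv with rfl | rfl | ⟨j, hj, rfl⟩
    · rfl
    · rw [ρ1, ρ2] at huv; exact absurd huv fanLeft_ne_fanRight
    · rw [ρ1, ρp j hj] at huv; exact absurd huv.symm (fanPoint_ne_fanLeft j)
    · rw [ρ1, ρ2] at huv; exact absurd huv.symm fanLeft_ne_fanRight
    · rfl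
    · rw [ρ2, ρp j hj] at huv; exact absurd huv.symm (fanPoint_ne_fanRight j)
    · rw [ρ1, ρp i hi] at huv; exact absurd huv (fanPoint_ne_fanLeft i)
    · rw [ρ2, ρp i hi] at huv; exact absurd huv (fanPoint_ne_fanRight i)
    · rw [ρp i hi, ρp j hj] at huv
      rw [fanPoint_injective huv]
  · intro v hv
    rw [hN] at hv
    obtain ⟨j, hj0, hj, rfl⟩ := hv
    rw [hcorner, ρp j hj]
    exact fanPoint_mem_interior hj0
  · rw [hcorner, fanComplex_space]
    congr 1
    simp only [Matrix.range_cons, Matrix.range_empty, Set.union_empty, Set.singleton_union]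
  · rw [fanComplex_vertices]
    ext x
    constructor
    · rintro (rfl | rfl | ⟨j, hj, rfl⟩)
      · exact ⟨_, (hU _).2 (Or.inl rfl), ρ1⟩
      · exact ⟨_, (hU _).2 (Or.inr (Or.inl rfl)), ρ2⟩
      · exact ⟨_, (hU _).2 (Or.inr (Or.inr ⟨j, hj, rfl⟩)), ρp j hj⟩
    · rintro ⟨v, hv, rfl⟩
      rcases (hU v).1 hv with rfl | rfl | ⟨j, hj, rfl⟩
      · exact Or.inl ρ1
      · exact Or.inr (Or.inl ρ2)
      · exact Or.inr (Or.inr ⟨j, hj, ρp j hj⟩)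
  · have h1 : ∀ j ≤ k, ({ρ (pt j), ρ (corner 1)} : Finset Plane) ∈ (fanComplex k).faces := by
      intro j hj
      rw [ρp j hj, ρ1, pair_mem_fanComplex_faces]
      exact (exists_isFanCell_fanPoint hj).1
    have h2 : ∀ j ≤ k, ({ρ (pt j), ρ (corner 2)} : Finset Plane) ∈ (fanComplex k).faces := by
      intro j hj
      rw [ρp j hj, ρ2, pair_mem_fanComplex_faces]
      exact (exists_isFanCell_fanPoint hj).2
    have h3 : ({ρ (corner 1), ρ (corner 2)} : Finset Plane) ∈ (fanComplex k).faces := by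
      rw [ρ1, ρ2, pair_mem_fanComplex_faces]
      exact ⟨_, IsFanCell.bottom, by simp, by simp⟩
    have h4 : ∀ i j, i < j → j ≤ k → (T.Adj (pt i) (pt j) ↔
        ({ρ (pt i), ρ (pt j)} : Finset Plane) ∈ (fanComplex k).faces) := by
      intro i j hij hj
      rw [ρp i (hij.le.trans hj), ρp j hj, fanPoint_pair_mem_faces hij hj, hadj i j hij hj]
    intro u hu v hv huv
    rcases (hU u).1 hu with rfl | rfl | ⟨i, hi, rfl⟩ <;>
      rcases (hU v).1 hv with rfl | rfl | ⟨j, hj, rfl⟩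
    · exact absurd rfl huv
    · exact iff_of_true hadj12 h3
    · rw [Finset.pair_comm]
      exact iff_of_true (hadj1 j hj).symm (h1 j hj)
    · rw [Finset.pair_comm]
      exact iff_of_true hadj12.symm h3
    · exact absurd rfl huv
    · rw [Finset.pair_comm]
      exact iff_of_true (hadj2 j hj).symm (h2 j hj)
    · exact iff_of_true (hadj1 i hi) (h1 i hi)
    · exact iff_of_true (hadj2 i hi) (h2 i hi)
    · rcases lt_trichotomy i j with h | rfl | h
      · exact h4 i j h hj
      · exact absurd rfl huv
      · rw [T.adj_comm, Finset.pair_comm]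
        exact h4 j i h hi

/-! ### The explicit filled octahedron -/

theorem blockStart_add_le {s : Fin 8 → ℕ} {i j : Fin 8} (hij : i < j) :
    blockStart s i + s i ≤ blockStart s j := by
  unfold blockStart
  rw [add_assoc, add_le_add_iff_left, add_comm, ← Finset.sum_insert (by simp)]
  refine Finset.sum_le_sum_of_subset fun k hk => ?_
  rcases Finset.mem_insert.1 hk with rfl | hk
  · simpa using hij
  · simp only [Finset.mem_filter, Finset.mem_univ, true_and] at hk ⊢
    exact hk.trans hij

theorem blockStart_add_le_sum (s : Fin 8 → ℕ) (i : Fin 8) :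
    blockStart s i + s i ≤ 6 + ∑ j, s j := by
  unfold blockStart
  rw [add_assoc, add_le_add_iff_left, add_comm, ← Finset.sum_insert (by simp)]
  exact Finset.sum_le_sum_of_subset (Finset.subset_univ _)

theorem six_le_blockStart (s : Fin 8 → ℕ) (i : Fin 8) : 6 ≤ blockStart s i :=
  Nat.le_add_right _ _

theorem InBlock.six_le {s : Fin 8 → ℕ} {i : Fin 8} {v : ℕ} (h : InBlock s i v) : 6 ≤ v :=
  (six_le_blockStart s i).trans h.1

theorem InBlock.unique {s : Fin 8 → ℕ} {i j : Fin 8} {v : ℕ} (hi : InBlock s i v)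
    (hj : InBlock s j v) : i = j := by
  rcases lt_trichotomy i j with h | h | h
  · have := blockStart_add_le (s := s) h
    have := hi.2
    have := hj.1
    omega
  · exact h
  · have := blockStart_add_le (s := s) h
    have := hj.2
    have := hi.1
    omega

/-- Each block begins where the previous one ends. A number in no block would be beyond all of them,
although the last one ends at `6 + ∑ j, s j`. -/
theorem exists_inBlock {s : Fin 8 → ℕ} {v : ℕ} (h6 : 6 ≤ v) (hv : v < 6 + ∑ j, s j) :
    ∃ i, InBlock s i v := by
  by_contra! hcon
  have hle : ∀ m : ℕ, ∀ hm : m < 8, blockStart s ⟨m, hm⟩ ≤ v := by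
    intro m
    induction m with
    | zero =>
      intro hm
      have : blockStart s ⟨0, hm⟩ = 6 := by
        unfold blockStart
        rw [Finset.sum_eq_zero, add_zero]
        intro j hj
        exact absurd (Finset.mem_filter.1 hj).2 (Fin.not_lt_zero j)
      omega
    | succ m ih =>
      intro hm
      have h1 := ih (by omega)
      have h2 : blockStart s ⟨m + 1, hm⟩ = blockStart s ⟨m, by omega⟩ + s ⟨m, by omega⟩ := by
        unfold blockStart
        rw [add_assoc, add_comm (∑ _ ∈ _, _), ← Finset.sum_insert (by simp)]
        congr 2
        ext j
        simp only [Finset.mem_filter, Finset.mem_univ, true_and, Finset.mem_insert, Fin.lt_def,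
          Fin.ext_iff]
        omega
      have h3 := hcon ⟨m, by omega⟩
      unfold InBlock at h3
      omega
  have h7 := hle 7 (by norm_num)
  have h8 : blockStart s 7 + s 7 = 6 + ∑ j, s j := by
    unfold blockStart
    rw [add_assoc, add_comm (∑ _ ∈ _, _), ← Finset.sum_insert (by simp)]
    congr 2
    ext j
    simp only [Finset.mem_filter, Finset.mem_univ, true_and, Finset.mem_insert, Fin.lt_def,
      Fin.ext_iff, iff_true]
    change j.val = 7 ∨ j.val < 7
    omega
  have h9 := hcon 7
  unfold InBlock at h9
  have h7' : blockStart s 7 ≤ v := h7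
  omega

/-- The relation that generates `stackedOctahedron`. -/
def StackedRel (s : Fin 8 → ℕ) (u v : ℕ) : Prop :=
  (∃ a b : Fin 6, u = a.val ∧ v = b.val ∧ octahedron.Adj a b) ∨
    ∃ i : Fin 8, InBlock s i u ∧
      ((InBlock s i v ∧ v = u + 1) ∨
        v = (octFace i 1).val ∨ v = (octFace i 2).val ∨
        (v = (octFace i 0).val ∧ u = blockStart s i))

theorem stackedOctahedron_adj {n : ℕ} {s : Fin 8 → ℕ} {u v : Fin n} :
    (stackedOctahedron n s).Adj u v ↔ u ≠ v ∧ (StackedRel s u v ∨ StackedRel s v u) :=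
  SimpleGraph.fromRel_adj _ u v

theorem StackedRel.of_lt {s : Fin 8 → ℕ} {u v : ℕ} (h : StackedRel s u v) (hu : u < 6) :
    ∃ a b : Fin 6, u = a.val ∧ v = b.val ∧ octahedron.Adj a b := by
  rcases h with h | ⟨i, hi, -⟩
  · exact h
  · have := hi.six_le
    omega

theorem StackedRel.of_inBlock {s : Fin 8 → ℕ} {u v : ℕ} (h : StackedRel s u v) {i : Fin 8}
    (hi : InBlock s i u) : (InBlock s i v ∧ v = u + 1) ∨
        v = (octFace i 1).val ∨ v = (octFace i 2).val ∨
        (v = (octFace i 0).val ∧ u = blockStart s i) := by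
  rcases h with ⟨a, b, rfl, -, -⟩ | ⟨j, hj, h⟩
  · have := hi.six_le
    omega
  · rwa [hi.unique hj]

theorem exists_octFace_of_adj {a b : Fin 6} (h : octahedron.Adj a b) :
    ∃ i k l, octFace i k = a ∧ octFace i l = b := by
  have h' : a.val % 3 ≠ b.val % 3 := h
  clear h
  revert a b
  decide

open Classical in
/-- The new vertices of `stackedOctahedron n s` in the `i`-th face. -/
noncomputable def blockVertices (n : ℕ) (s : Fin 8 → ℕ) (i : Fin 8) : Finset (Fin n) :=
  Finset.univ.filter fun v => InBlock s i v.val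

theorem mem_blockVertices {n : ℕ} {s : Fin 8 → ℕ} {i : Fin 8} {v : Fin n} :
    v ∈ blockVertices n s i ↔ InBlock s i v.val := by
  simp [blockVertices]

theorem card_blockVertices {n : ℕ} {s : Fin 8 → ℕ} (hs : 6 + ∑ j, s j = n) (i : Fin 8) :
    (blockVertices n s i).card = s i := by
  have h : (blockVertices n s i).map Fin.valEmbedding =
      Finset.Ico (blockStart s i) (blockStart s i + s i) := by
    ext v
    simp only [Finset.mem_map, mem_blockVertices, Fin.valEmbedding_apply, Finset.mem_Ico]
    constructor
    · rintro ⟨u, hu, rfl⟩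
      exact hu
    · intro hv
      have := blockStart_add_le_sum s i
      exact ⟨⟨v, by omega⟩, hv, rfl⟩
  rw [← Finset.card_map Fin.valEmbedding, h, Nat.card_Ico, Nat.add_sub_cancel_left]

theorem stackedOctahedron_face {n : ℕ} (h6 : 6 ≤ n) {s : Fin 8 → ℕ} (hs : 6 + ∑ j, s j = n)
    (i : Fin 8) : IsTriangulatedFace (stackedOctahedron n s) (Fin.castLE h6 ∘ octFace i)
      (blockVertices n s i : Set (Fin n)) := by
  have hbound := blockStart_add_le_sum s i
  have hst := six_le_blockStart s i
  -- Index 0 stands for the corner `x`, which is also the default value; index `j` from 1 to `s i`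
  -- stands for the `j`-th new vertex, hence the shift by one.
  set pt : ℕ → Fin n := fun j =>
    if h : 0 < j ∧ j ≤ s i then ⟨blockStart s i + j - 1, by omega⟩
    else Fin.castLE h6 (octFace i 0) with hpt
  have pt0 : pt 0 = Fin.castLE h6 (octFace i 0) := dif_neg (by omega)
  have ptval : ∀ j, 0 < j → j ≤ s i → (pt j).val = blockStart s i + j - 1 := by
    intro j h1 h2
    simp only [hpt]
    rw [dif_pos ⟨h1, h2⟩]
  have ptblock : ∀ j, 0 < j → j ≤ s i → InBlock s i (pt j).val := by
    intro j h1 h2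
    rw [ptval j h1 h2]
    constructor <;> omega
  have cval : ∀ k, (Fin.castLE h6 (octFace i k)).val = (octFace i k).val := fun k => rfl
  have hc6 : ∀ k, (octFace i k).val < 6 := fun k => (octFace i k).isLt
  have hcadj : ∀ k l, k ≠ l → (stackedOctahedron n s).Adj (Fin.castLE h6 (octFace i k))
      (Fin.castLE h6 (octFace i l)) := by
    intro k l hkl
    refine stackedOctahedron_adj.2 ⟨?_, Or.inl (Or.inl ⟨_, _, rfl, rfl,
      octahedron_adj_octFace i hkl⟩)⟩
    exact fun h => hkl (octFace_injective i (Fin.castLE_injective h6 h))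
  have hne : ∀ j, 0 < j → j ≤ s i → ∀ k, pt j ≠ Fin.castLE h6 (octFace i k) := by
    intro j h1 h2 k h
    have h3 := (ptblock j h1 h2).six_le
    rw [h, cval] at h3
    have := hc6 k
    omega
  refine isTriangulatedFace_fan (k := s i) pt
    (fun v => if v.val < 6 then 0 else v.val - blockStart s i + 1) ?_ pt0 ?_ ?_ ?_ ?_ ?_ ?_ ?_ ?_
  · intro j hj
    rcases j.eq_zero_or_pos with rfl | h
    · rw [pt0]
      exact if_pos (hc6 0)
    · rw [ptval j h hj, if_neg (by omega)]
      omega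
  · exact (hcadj 1 2 (by decide)).ne
  · intro j hj
    rcases j.eq_zero_or_pos with rfl | h
    · rw [pt0]
      exact (hcadj 0 1 (by decide)).ne
    · exact hne j h hj 1
  · intro j hj
    rcases j.eq_zero_or_pos with rfl | h
    · rw [pt0]
      exact (hcadj 0 2 (by decide)).ne
    · exact hne j h hj 2
  · exact hcadj 1 2 (by decide)
  · intro j hj
    rcases j.eq_zero_or_pos with rfl | h
    · rw [pt0]
      exact hcadj 0 1 (by decide)
    · exact stackedOctahedron_adj.2 ⟨hne j h hj 1,
        Or.inl (Or.inr ⟨i, ptblock j h hj, Or.inr (Or.inl rfl)⟩)⟩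
  · intro j hj
    rcases j.eq_zero_or_pos with rfl | h
    · rw [pt0]
      exact hcadj 0 2 (by decide)
    · exact stackedOctahedron_adj.2 ⟨hne j h hj 2,
        Or.inl (Or.inr ⟨i, ptblock j h hj, Or.inr (Or.inr (Or.inl rfl))⟩)⟩
  · intro l j hlj hj
    have hj0 : 0 < j := by omega
    have hjb := ptblock j hj0 hj
    have hjv := ptval j hj0 hj
    have hj6 := hjb.six_le
    rcases l.eq_zero_or_pos with rfl | hl
    · rw [pt0, stackedOctahedron_adj]
      constructor
      · rintro ⟨-, h | h⟩
        · obtain ⟨a, b, -, hb, -⟩ := h.of_lt (hc6 0)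
          omega
        · have hcn : ∀ k : Fin 3, 0 ≠ k → (octFace i 0).val ≠ (octFace i k).val :=
            fun k hk h => hk (octFace_injective i (Fin.ext h))
          rcases h.of_inBlock hjb with ⟨h, -⟩ | h | h | ⟨-, h⟩
          · exact absurd h.six_le (not_le.2 (hc6 0))
          · exact absurd h (hcn 1 (by decide))
          · exact absurd h (hcn 2 (by decide))
          · omega
      · rintro rfl
        refine ⟨(hne _ hj0 hj 0).symm, Or.inr (Or.inr ⟨i, hjb, Or.inr (Or.inr (Or.inr ⟨rfl, ?_⟩))⟩)⟩
        omega
    · have hlb := ptblock l hl (by omega)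
      have hlv := ptval l hl (by omega)
      have hl6 := hlb.six_le
      have := hc6 0
      have := hc6 1
      have := hc6 2
      rw [stackedOctahedron_adj]
      constructor
      · rintro ⟨-, h | h⟩
        · rcases h.of_inBlock hlb with ⟨-, h⟩ | h | h | ⟨h, -⟩ <;> omega
        · rcases h.of_inBlock hjb with ⟨-, h⟩ | h | h | ⟨h, -⟩ <;> omega
      · rintro rfl
        refine ⟨fun h => ?_, Or.inl (Or.inr ⟨i, hlb, Or.inl ⟨hjb, by omega⟩⟩)⟩
        have := congrArg Fin.val h
        omega
  · ext v
    rw [Finset.mem_coe, mem_blockVertices]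
    constructor
    · rintro ⟨h1, h2⟩
      refine ⟨v.val - blockStart s i + 1, by omega, by omega, Fin.ext ?_⟩
      rw [ptval _ (by omega) (by omega)]
      omega
    · rintro ⟨j, h1, h2, rfl⟩
      exact ptblock j h1 h2

theorem isFilledOctahedron_stackedOctahedron {n : ℕ} (h6 : 6 ≤ n) {s : Fin 8 → ℕ}
    (hs : s ∈ faceCounts n) : IsFilledOctahedron h6 s (stackedOctahedron n s) := by
  have hsum : 6 + ∑ j, s j = n := by
    rw [sum_of_mem_faceCounts hs]
    omega
  refine (isFilledOctahedron_iff h6 _ _).2 ⟨blockVertices n s, ⟨card_blockVertices hsum, ?_, ?_, ?_,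
    ?_, stackedOctahedron_face h6 hsum⟩⟩
  · intro v hv
    obtain ⟨i, hi⟩ := exists_inBlock (s := s) hv (hsum ▸ v.isLt)
    exact ⟨i, mem_blockVertices.2 hi, fun j hj => (mem_blockVertices.1 hj).unique hi⟩
  · exact fun i v hv => (mem_blockVertices.1 hv).six_le
  · ext a b
    rw [SimpleGraph.comap_adj, stackedOctahedron_adj]
    have key : ∀ a b : Fin 6, StackedRel s (Fin.castLE h6 a).val (Fin.castLE h6 b).val →
        octahedron.Adj a b := by
      intro a b h
      obtain ⟨a', b', ha, hb, hab⟩ := h.of_lt a.isLt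
      rwa [Fin.ext (a := a) ha, Fin.ext (a := b) hb]
    constructor
    · rintro ⟨-, h | h⟩
      · exact key a b h
      · exact (key b a h).symm
    · intro h
      exact ⟨fun e => h.ne (Fin.castLE_injective h6 e), Or.inl (Or.inl ⟨a, b, rfl, rfl, h⟩)⟩
  · have key : ∀ u v : Fin n, StackedRel s u v → ∃ i,
        u ∈ Set.range (Fin.castLE h6 ∘ octFace i) ∪ (blockVertices n s i : Set (Fin n)) ∧
        v ∈ Set.range (Fin.castLE h6 ∘ octFace i) ∪ (blockVertices n s i : Set (Fin n)) := by
      rintro u v (⟨a, b, ha, hb, hab⟩ | ⟨i, hi, h⟩)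
      · obtain ⟨i, k, l, rfl, rfl⟩ := exists_octFace_of_adj hab
        exact ⟨i, Or.inl ⟨k, Fin.ext ha.symm⟩, Or.inl ⟨l, Fin.ext hb.symm⟩⟩
      · refine ⟨i, Or.inr (mem_blockVertices.2 hi), ?_⟩
        rcases h with ⟨h, -⟩ | h | h | ⟨h, -⟩
        · exact Or.inr (mem_blockVertices.2 h)
        · exact Or.inl ⟨1, Fin.ext h.symm⟩
        · exact Or.inl ⟨2, Fin.ext h.symm⟩
        · exact Or.inl ⟨0, Fin.ext h.symm⟩
    intro u v huv
    rcases (stackedOctahedron_adj.1 huv).2 with h | h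
    · exact key u v h
    · obtain ⟨i, h1, h2⟩ := key v u h
      exact ⟨i, h2, h1⟩

/-! ### The conflict collections -/

theorem isConflictCollection_filledOctahedra {n : ℕ} (h6 : 6 ≤ n) {S : Finset (Fin 8 → ℕ)}
    (hS : n.descFactorial 6 < S.card) (T : (Fin 8 → ℕ) → SimpleGraph (Fin n))
    (hT : ∀ s ∈ S, IsFilledOctahedron h6 s (T s)) :
    IsConflictCollection (T '' (S : Set (Fin 8 → ℕ))) := by
  refine ⟨?_, not_isSimultaneouslyEmbeddable h6 hS T hT⟩
  rintro _ ⟨s, hs, rfl⟩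
  exact (hT s hs).isPlanar

/-- The graph determines its counts, so `T` is injective on `S`. -/
theorem ncard_filledOctahedra {n : ℕ} (h6 : 6 ≤ n) {S : Finset (Fin 8 → ℕ)}
    (T : (Fin 8 → ℕ) → SimpleGraph (Fin n)) (hT : ∀ s ∈ S, IsFilledOctahedron h6 s (T s)) :
    (T '' (S : Set (Fin 8 → ℕ))).ncard = S.card := by
  rw [Set.InjOn.ncard_image, Set.ncard_coe_finset]
  intro s hs s' hs' heq
  obtain ⟨N, hN⟩ := (isFilledOctahedron_iff h6 _ _).1 (hT s hs)
  obtain ⟨N', hN'⟩ := (isFilledOctahedron_iff h6 _ _).1 (hT s' hs')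
  rw [heq] at hN
  exact hN.counts_eq hN'

theorem theorem3 (n : ℕ) (hn : 5040 ≤ n) :
    -- the explicit collection
    (IsConflictCollection (explicitCollection n) ∧
      (explicitCollection n).ncard = n.descFactorial 6 + 1) ∧
    -- it is an instance of the general construction
    (selectedCounts n ⊆ faceCounts n ∧ (selectedCounts n).card = n.descFactorial 6 + 1) ∧
    (∀ s ∈ faceCounts n,
      IsFilledOctahedron (le_trans (by norm_num) hn) s (stackedOctahedron n s)) ∧
    -- every choice in the general construction gives such a collection
    (∀ S : Finset (Fin 8 → ℕ), S ⊆ faceCounts n → S.card = n.descFactorial 6 + 1 →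
      ∀ T : (Fin 8 → ℕ) → SimpleGraph (Fin n),
        (∀ s ∈ S, IsFilledOctahedron (le_trans (by norm_num) hn) s (T s)) →
        IsConflictCollection (T '' (S : Set (Fin 8 → ℕ))) ∧
          (T '' (S : Set (Fin 8 → ℕ))).ncard = n.descFactorial 6 + 1) := by
  have h6 : 6 ≤ n := le_trans (by norm_num) hn
  have hgen : ∀ S : Finset (Fin 8 → ℕ), S.card = n.descFactorial 6 + 1 →
      ∀ T : (Fin 8 → ℕ) → SimpleGraph (Fin n), (∀ s ∈ S, IsFilledOctahedron h6 s (T s)) →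
        IsConflictCollection (T '' (S : Set (Fin 8 → ℕ))) ∧
          (T '' (S : Set (Fin 8 → ℕ))).ncard = n.descFactorial 6 + 1 := fun S hS T hT =>
    ⟨isConflictCollection_filledOctahedra h6 (by omega) T hT,
      (ncard_filledOctahedra h6 T hT).trans hS⟩
  have hstack : ∀ s ∈ faceCounts n, IsFilledOctahedron h6 s (stackedOctahedron n s) :=
    fun s hs => isFilledOctahedron_stackedOctahedron h6 hs
  exact ⟨hgen _ (card_selectedCounts hn) _ fun s hs => hstack s (selectedCounts_subset n hs),
    ⟨selectedCounts_subset n, card_selectedCounts hn⟩, hstack, fun S _ hS T hT => hgen S hS T hT⟩
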